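/- For an integer $n\ge 1$ let $\mathcal S_n^{\rm loc}$ be the set of continuous, piecewise linear functions $f:[0,n]\to\mathbb R$ with $f(0)=0$ and $f'(x)\in\{-1,1\}$ for every $x\in(0,n)\setminus\mathbb Z$. For $\rho\in[-1,1]$ and $f\in\mathcal S_n^{\rm loc}$ put $$\theta_n^\rho(f):=\int_0^n\int_0^n\Big(\frac{f(x)-f(y)}{x-y}-\rho\Big)^2dx\,dy,\qquad \tilde\theta_n(f):=\sum_{c}\varphi(h_c),\qquad \varphi(x):=\sum_{k=1}^\infty\frac{1}{k(k+1)(2k+1)x^{2k}}.$$ Here the plane is tiled by the squares of side length $\sqrt2$ with sides of slope $\pm1$, placed so that the origin is a vertex; $c$ runs over the squares of the tiling (the cells) that lie below the graph of $f$ and above the graph of $x\mapsto\max(-x,\,x-n+f(n))$ on $[0,n]$; and the hook length $h_c$ is the number of these cells that are $c$ itself, or lie beyond $c$ in its diagonal row in the direction $(1,1)$, or lie beyond $c$ in its diagonal row in the direction $(-1,1)$. Let $$\Theta_n^\rho(f):=\tfrac18\theta_n^\rho(f)+\tilde\theta_n(f),\qquad \sigma_n^\rho:=\min_{f\in\mathcal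 S_n^{\rm loc}}\Theta_n^\rho(f).$$ Then these minima are attained, and there is a universal constant $C>0$ such that for every $\rho\in[-1,1]$ there is a constant $\sigma^\rho\ge0$ with $$\Big|\frac{\sigma_n^\rho}{n}-\sigma^\rho\Big|\le\frac{C}{\log n}\qquad\text{for all integers } n\ge2.$$ Moreover, the function $\rho\mapsto\sigma^\rho$ is continuous on $[-1,1]$. -/

import Mathlib

namespace LocalOpt

/-- The local lattice-path functions on `[0, n]`: continuous, with `f 0 = 0`, and with slope `1` or
`-1` at every non-integer point (hence linear between consecutive integers).
Only the values on `[0, n]` are relevant. -/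
def Sloc (n : ℕ) : Set (ℝ → ℝ) :=
  {f | ContinuousOn f (Set.Icc 0 (n : ℝ)) ∧ f 0 = 0 ∧
    ∀ x ∈ Set.Ioo 0 (n : ℝ), x ∉ Set.range (Int.cast : ℤ → ℝ) →
      HasDerivAt f 1 x ∨ HasDerivAt f (-1) x}

/-- The double-integral energy of `f` on `[0, n]` relative to the line of slope `ρ`. -/
noncomputable def theta (n : ℕ) (ρ : ℝ) (f : ℝ → ℝ) : ℝ :=
  ∫ y in (0 : ℝ)..n, ∫ x in (0 : ℝ)..n, ((f x - f y) / (x - y) - ρ) ^ 2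

/-- `φ(x) = ∑_{k ≥ 1} 1 / (k (k + 1) (2 k + 1) x ^ (2 k))`, with the index shifted by one. -/
noncomputable def phi (x : ℝ) : ℝ :=
  ∑' k : ℕ, 1 / (((k : ℝ) + 1) * ((k : ℝ) + 2) * (2 * (k : ℝ) + 3) * x ^ (2 * (k + 1)))

/-- The cell with index `c = (p, q)`: the closed square of side length `√2`, rotated by 45 degrees,
whose lowest vertex is the point `(p - q, p + q)`. These squares tile the plane, and `(0, 0)` is one
of their vertices. Raising `p` moves the cell up and to the right, raising `q` moves it up and
to the left. -/
def cell (c : ℤ × ℤ) : Set (ℝ × ℝ) :=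
  {z | 2 * (c.1 : ℝ) ≤ z.1 + z.2 ∧ z.1 + z.2 ≤ 2 * (c.1 : ℝ) + 2 ∧
    2 * (c.2 : ℝ) ≤ z.2 - z.1 ∧ z.2 - z.1 ≤ 2 * (c.2 : ℝ) + 2}

/-- The region over `[0, n]` below the graph of `f` and above
the graph of `x ↦ max (-x) (x - n + f n)`. -/
def region (n : ℕ) (f : ℝ → ℝ) : Set (ℝ × ℝ) :=
  {z | z.1 ∈ Set.Icc 0 (n : ℝ) ∧ max (-z.1) (z.1 - n + f n) ≤ z.2 ∧ z.2 ≤ f z.1}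

/-- The cells that are trapped in the region. -/
def cells (n : ℕ) (f : ℝ → ℝ) : Set (ℤ × ℤ) :=
  {c | cell c ⊆ region n f}

theorem cells_finite (n : ℕ) (f : ℝ → ℝ) : (cells n f).Finite := by
  have hfin : (⋃ d ∈ Set.Icc (0 : ℤ) n, (fun p : ℤ => (p, p - d)) ''
      Set.Icc (0 : ℤ) (⌊f d⌋ + n)).Finite :=
    (Set.finite_Icc _ _).biUnion fun d _ => (Set.finite_Icc _ _).image _
  refine hfin.subset ?_
  rintro ⟨p, q⟩ hc
  have hz : (((p : ℝ) - q, (p : ℝ) + q) : ℝ × ℝ) ∈ region n f := by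
    apply hc
    refine ⟨?_, ?_, ?_, ?_⟩ <;> dsimp only <;> linarith
  obtain ⟨⟨h0, h1⟩, h2, h3⟩ := hz
  have h4 := (max_le_iff.1 h2).1
  simp only at h0 h1 h3 h4
  have hd0 : 0 ≤ p - q := by exact_mod_cast h0
  have hd1 : p - q ≤ n := by exact_mod_cast h1
  have hp : 0 ≤ p := by
    have : (0 : ℝ) ≤ p := by linarith
    exact_mod_cast this
  have hf : p + q ≤ ⌊f ((p - q : ℤ) : ℝ)⌋ := by
    rw [Int.le_floor]
    push_cast
    exact h3
  simp only [Set.mem_iUnion]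
  exact ⟨p - q, ⟨hd0, hd1⟩, p, ⟨hp, by omega⟩, by simp⟩

/-- The hook length of the cell `c`: the number of cells of the diagram in the hook of `c`, that is
`c` itself, the cells beyond it towards the upper right and those beyond it
towards the upper left. -/
noncomputable def hookLength (n : ℕ) (f : ℝ → ℝ) (c : ℤ × ℤ) : ℕ :=
  {d ∈ cells n f | (d.2 = c.2 ∧ c.1 ≤ d.1) ∨ (d.1 = c.1 ∧ c.2 ≤ d.2)}.ncard

/-- The hook-length sum. -/
noncomputable def thetaTilde (n : ℕ) (f : ℝ → ℝ) : ℝ :=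
  ∑ c ∈ (cells_finite n f).toFinset, phi (hookLength n f c)

/-- The local functional. -/
noncomputable def Theta (n : ℕ) (ρ : ℝ) (f : ℝ → ℝ) : ℝ :=
  1 / 8 * theta n ρ f + thetaTilde n f

/-- The optimal local value, the minimum of `Theta n ρ` over `Sloc n`. -/
noncomputable def sigmaLoc (n : ℕ) (ρ : ℝ) : ℝ :=
  sInf (Theta n ρ '' Sloc n)

end LocalOpt

namespace LocalOpt

open Finset

/-! A path in `Sloc n` is a sequence of `n` steps `±1`. Cutting `[0, n]²` into unit squares turns
the double integral into a sum of interactions `W ρ s i j`. A trapped cell is an up-step `i`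
followed by a down-step `j`, and its hook length is `j - i`. Hence `Theta` equals `E`, a sum of
nonnegative translation-invariant pair terms (`Theta_eq`), and the minimum runs over finitely many
values.

Dropping the interaction between two consecutive pieces makes `minE` superadditive. With a linear
upper bound, Fekete's lemma gives the density `σ` as limit and supremum of `minE ρ n / n`.
Nonnegativity is then immediate, and what remains is `σ ≤ minE ρ n / n + O(1 / log n)`, uniformly in
`ρ`.

For this, a window of length `L` is cut from an optimal path of length `n`, and corrected copies of
it are laid end to end into arbitrarily long paths. Each copy first gets a prescribed number of
up-steps by proportional thinning (`exists_thinning`), which keeps the long path within 2 of the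
line of slope `ρ` at all block ends. The cost of the thinning and the interaction between blocks are
controlled by `tilt` and `edge`, up to a small multiple of the energy and terms that are negligible
against `L` (`minE_mul_le`).

Up to bounded errors, `W ρ s i j` is the squared difference of the deviations over the squared gap
(`W_le`, `dev_sub_sq_le`). Averaged over all windows, `tilt` and `edge` are therefore bounded by the
sum of `shortW`, that is of `W` weighted by `√(gap / L)` and cut off at gap `2 L`. This weight
decays geometrically in the scale, so over `L = 16 ^ j` each pair is counted a bounded number of
times in total (`sum_shortW_le`). Among about `log n` scales one therefore has a `shortW` sum of
order `n / log n`; at that scale the error is `O(1 / log n)` (`density_le`).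

For fixed `n` the function `minE ρ n` is Lipschitz in `ρ`. The rate is uniform in `ρ`, so `σ` is a
uniform limit of continuous functions. -/

/-! ### Step sequences and their heights -/

/-- Sequences of up and down steps. -/
def IsStep (s : ℕ → ℤ) : Prop := ∀ i, s i = 1 ∨ s i = -1

/-- The height reached after `i` steps. -/
def ht (s : ℕ → ℤ) (i : ℕ) : ℤ := ∑ t ∈ range i, s t

theorem ht_zero (s : ℕ → ℤ) : ht s 0 = 0 := by simp [ht]

theorem ht_succ (s : ℕ → ℤ) (i : ℕ) : ht s (i + 1) = ht s i + s i := by simp [ht, sum_range_succ]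

theorem ht_shift (s : ℕ → ℤ) (u i : ℕ) : ht (fun t => s (u + t)) i = ht s (u + i) - ht s u := by
  induction i with
  | zero => simp [ht]
  | succ i ih => rw [ht_succ, ih, ← add_assoc, ht_succ]; ring

theorem IsStep.shift {s : ℕ → ℤ} (hs : IsStep s) (u : ℕ) : IsStep fun t => s (u + t) :=
  fun i => hs (u + i)

theorem IsStep.abs_cast {s : ℕ → ℤ} (hs : IsStep s) (i : ℕ) : |(s i : ℝ)| = 1 := by
  rcases hs i with h | h <;> simp [h]

theorem IsStep.abs_ht_sub_le {s : ℕ → ℤ} (hs : IsStep s) (i k : ℕ) :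
    |(ht s (i + k) : ℝ) - ht s i| ≤ k := by
  induction k with
  | zero => simp
  | succ k ih =>
    rw [← add_assoc, ht_succ]
    push_cast
    have := hs.abs_cast (i + k)
    calc _ = |((ht s (i + k) : ℝ) - ht s i) + s (i + k)| := by congr 1; ring
      _ ≤ _ := (abs_add_le _ _).trans (by linarith)

/-- The value at `i + a` minus the value at `j + b` of the piecewise linear path. -/
theorem IsStep.abs_increment_le {s : ℕ → ℤ} (hs : IsStep s) (i j : ℕ) {a b : ℝ}
    (ha : a ∈ Set.Icc (0 : ℝ) 1) (hb : b ∈ Set.Icc (0 : ℝ) 1) :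
    |((ht s i : ℝ) - ht s j) + a * s i - b * s j| ≤ |(i : ℝ) - j + a - b| := by
  have key : ∀ (i k : ℕ) (a b : ℝ), a ∈ Set.Icc (0 : ℝ) 1 → b ∈ Set.Icc (0 : ℝ) 1 →
      |((ht s (i + 1 + k) : ℝ) - ht s i) + b * s (i + 1 + k) - a * s i| ≤ 1 + k + b - a := by
    intro i k a b ha hb
    have h1 := hs.abs_ht_sub_le (i + 1) k
    rw [ht_succ] at h1
    push_cast at h1
    have h2 : |b * (s (i + 1 + k) : ℝ)| = b := by
      rw [abs_mul, hs.abs_cast, abs_of_nonneg hb.1, mul_one]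
    have h3 : |(1 - a) * (s i : ℝ)| = 1 - a := by
      rw [abs_mul, hs.abs_cast, abs_of_nonneg (by linarith [ha.2]), mul_one]
    calc _ = |((ht s (i + 1 + k) : ℝ) - (ht s i + s i)) + (1 - a) * s i
          + b * s (i + 1 + k)| := by congr 1; ring
      _ ≤ _ := (abs_add_three _ _ _).trans (by linarith)
  rcases lt_trichotomy i j with h | rfl | h
  · obtain ⟨k, rfl⟩ := Nat.exists_eq_add_of_le h
    have := key i k a b ha hb
    rw [abs_sub_comm] at this
    have hk : (0 : ℝ) ≤ k := k.cast_nonneg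
    rw [abs_sub_comm _ b, show b - ((i : ℝ) - ((i.succ + k : ℕ) : ℝ) + a) = 1 + k + b - a by
      push_cast; ring, abs_of_nonneg (a := 1 + (k : ℝ) + b - a) (by linarith [ha.2, hb.1])]
    refine le_trans (le_of_eq ?_) this
    congr 1
    simp only [Nat.succ_eq_add_one]
    ring
  · rw [show ((ht s i : ℝ) - ht s i) + a * s i - b * s i = (a - b) * s i by ring, abs_mul,
      hs.abs_cast]
    simp
  · obtain ⟨k, rfl⟩ := Nat.exists_eq_add_of_le h
    have := key j k b a hb ha
    have hk : (0 : ℝ) ≤ k := k.cast_nonneg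
    rw [show ((j.succ + k : ℕ) : ℝ) - j + a - b = 1 + k + a - b by push_cast; ring,
      abs_of_nonneg (a := 1 + (k : ℝ) + a - b) (by linarith [ha.1, hb.2])]
    exact this

/-! ### The interaction of two unit intervals -/

/-- The integrand of `theta` on a product of two unit intervals on which the path is linear. -/
noncomputable def kern (ρ d Δ v w b a : ℝ) : ℝ := ((Δ + a * v - b * w) / (d + a - b) - ρ) ^ 2

/-- The contribution of the unit intervals `[i, i + 1]` and `[j, j + 1]` to `theta`. -/
noncomputable def W (ρ : ℝ) (s : ℕ → ℤ) (i j : ℕ) : ℝ :=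
  ∫ b in (0 : ℝ)..1, ∫ a in (0 : ℝ)..1,
    kern ρ ((i : ℝ) - j) ((ht s i : ℝ) - ht s j) (s i) (s j) b a

theorem measurable_kern (ρ d Δ v w : ℝ) :
    Measurable fun z : ℝ × ℝ => kern ρ d Δ v w z.1 z.2 := by
  unfold kern
  fun_prop

theorem setIntegral_bounded_integrable {k : ℝ → ℝ → ℝ} (hk : Measurable fun z : ℝ × ℝ => k z.1 z.2)
    {M p q p' q' : ℝ} (hM : ∀ b ∈ Set.Icc p q, ∀ a ∈ Set.Icc p' q', |k b a| ≤ M) :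
    MeasureTheory.IntegrableOn (fun z : ℝ × ℝ => k z.1 z.2) (Set.Icc p q ×ˢ Set.Icc p' q') := by
  refine MeasureTheory.Measure.integrableOn_of_bounded (M := M) ?_ hk.aestronglyMeasurable ?_
  · rw [MeasureTheory.Measure.volume_eq_prod, MeasureTheory.Measure.prod_prod]
    exact (ENNReal.mul_lt_top (by simp) (by simp)).ne
  · refine (MeasureTheory.ae_restrict_iff' (measurableSet_Icc.prod measurableSet_Icc)).2 ?_
    exact Filter.Eventually.of_forall fun z hz => hM _ hz.1 _ hz.2

/-- Iterated integrals over a rectangle are set integrals over it. -/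
theorem iterated_eq_setIntegral {k : ℝ → ℝ → ℝ} (hk : Measurable fun z : ℝ × ℝ => k z.1 z.2)
    {M p q p' q' : ℝ} (hpq : p ≤ q) (hpq' : p' ≤ q')
    (hM : ∀ b ∈ Set.Icc p q, ∀ a ∈ Set.Icc p' q', |k b a| ≤ M) :
    ∫ b in p..q, ∫ a in p'..q', k b a
      = ∫ z in Set.Icc p q ×ˢ Set.Icc p' q', k z.1 z.2 := by
  have hI := setIntegral_bounded_integrable hk hM
  rw [MeasureTheory.Measure.volume_eq_prod] at hI ⊢
  rw [MeasureTheory.setIntegral_prod _ hI, intervalIntegral.integral_of_le hpq,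
    MeasureTheory.integral_Icc_eq_integral_Ioc]
  refine MeasureTheory.setIntegral_congr_fun measurableSet_Ioc fun b _ => ?_
  simp only
  rw [intervalIntegral.integral_of_le hpq', MeasureTheory.integral_Icc_eq_integral_Ioc]

/-- Turns pointwise bounds on `kern` into bounds on `W`; `B` survives unchanged because the unit
square has area 1. Only measurability and boundedness are asked, since `kern` can be discontinuous
where its denominator vanishes. -/
theorem unit_integral_le {k k' : ℝ → ℝ → ℝ} (hk : Measurable fun z : ℝ × ℝ => k z.1 z.2)
    (hk' : Measurable fun z : ℝ × ℝ => k' z.1 z.2) {M M' A B : ℝ}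
    (hM : ∀ b ∈ Set.Icc (0 : ℝ) 1, ∀ a ∈ Set.Icc (0 : ℝ) 1, |k b a| ≤ M)
    (hM' : ∀ b ∈ Set.Icc (0 : ℝ) 1, ∀ a ∈ Set.Icc (0 : ℝ) 1, |k' b a| ≤ M')
    (h : ∀ b ∈ Set.Icc (0 : ℝ) 1, ∀ a ∈ Set.Icc (0 : ℝ) 1, k b a ≤ A * k' b a + B) :
    ∫ b in (0 : ℝ)..1, ∫ a in (0 : ℝ)..1, k b a
      ≤ A * (∫ b in (0 : ℝ)..1, ∫ a in (0 : ℝ)..1, k' b a) + B := by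
  rw [iterated_eq_setIntegral hk zero_le_one zero_le_one hM,
    iterated_eq_setIntegral hk' zero_le_one zero_le_one hM']
  have hI := setIntegral_bounded_integrable hk hM
  have hI' := setIntegral_bounded_integrable hk' hM'
  have hc : MeasureTheory.IntegrableOn (fun _ : ℝ × ℝ => B)
      (Set.Icc (0 : ℝ) 1 ×ˢ Set.Icc (0 : ℝ) 1) :=
    setIntegral_bounded_integrable (k := fun _ _ => B) measurable_const (M := |B|)
      fun _ _ _ _ => le_rfl
  have hv : MeasureTheory.volume.real (Set.Icc (0 : ℝ) 1 ×ˢ Set.Icc (0 : ℝ) 1) = 1 := by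
    rw [MeasureTheory.measureReal_def, MeasureTheory.Measure.volume_eq_prod,
      MeasureTheory.Measure.prod_prod]
    simp
  have := MeasureTheory.setIntegral_mono_on hI ((hI'.const_mul A).add hc)
    (measurableSet_Icc.prod measurableSet_Icc) fun z hz => h _ hz.1 _ hz.2
  refine this.trans (le_of_eq ?_)
  simp only [Pi.add_apply]
  rw [MeasureTheory.integral_add (hI'.const_mul A) hc, MeasureTheory.integral_const_mul,
    MeasureTheory.setIntegral_const, hv]
  simp

variable {ρ : ℝ} {s : ℕ → ℤ}

theorem kern_nonneg (ρ d Δ v w b a : ℝ) : 0 ≤ kern ρ d Δ v w b a := sq_nonneg _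

/-- The path is 1-Lipschitz, so its difference quotient and `ρ` both lie in `[-1, 1]`. Where the
denominator vanishes, the quotient is 0 by convention and the bound persists. -/
theorem kern_le_four (hρ : |ρ| ≤ 1) (hs : IsStep s) (i j : ℕ) {a b : ℝ}
    (hb : b ∈ Set.Icc (0 : ℝ) 1) (ha : a ∈ Set.Icc (0 : ℝ) 1) :
    kern ρ ((i : ℝ) - j) ((ht s i : ℝ) - ht s j) (s i) (s j) b a ≤ 4 := by
  have h1 := hs.abs_increment_le i j ha hb
  have h2 : |((ht s i : ℝ) - ht s j + a * s i - b * s j) / ((i : ℝ) - j + a - b)| ≤ 1 := by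
    rw [abs_div]
    exact div_le_one_of_le₀ h1 (abs_nonneg _)
  unfold kern
  rw [← sq_abs]
  calc _ ≤ ((1 : ℝ) + 1) ^ 2 := by
        gcongr
        exact (abs_sub _ _).trans (add_le_add h2 hρ)
    _ = 4 := by norm_num

theorem abs_kern_le_four (hρ : |ρ| ≤ 1) (hs : IsStep s) (i j : ℕ) :
    ∀ b ∈ Set.Icc (0 : ℝ) 1, ∀ a ∈ Set.Icc (0 : ℝ) 1,
      |kern ρ ((i : ℝ) - j) ((ht s i : ℝ) - ht s j) (s i) (s j) b a| ≤ 4 := by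
  intro b hb a ha
  rw [abs_of_nonneg (kern_nonneg _ _ _ _ _ _ _)]
  exact kern_le_four hρ hs i j hb ha

theorem W_nonneg (ρ : ℝ) (s : ℕ → ℤ) (i j : ℕ) : 0 ≤ W ρ s i j :=
  intervalIntegral.integral_nonneg zero_le_one fun _ _ =>
    intervalIntegral.integral_nonneg zero_le_one fun _ _ => kern_nonneg _ _ _ _ _ _ _

theorem W_le_of_kern_le (hρ : |ρ| ≤ 1) (hs : IsStep s) (i j : ℕ) {B : ℝ}
    (h : ∀ b ∈ Set.Icc (0 : ℝ) 1, ∀ a ∈ Set.Icc (0 : ℝ) 1,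
      kern ρ ((i : ℝ) - j) ((ht s i : ℝ) - ht s j) (s i) (s j) b a ≤ B) : W ρ s i j ≤ B := by
  have := unit_integral_le (A := 0) (B := B) (M' := 0)
    (measurable_kern ρ ((i : ℝ) - j) ((ht s i : ℝ) - ht s j) (s i) (s j))
    (k' := fun _ _ => 0) measurable_const (abs_kern_le_four hρ hs i j) (by simp)
    (by simpa using h)
  simpa [W] using this

/-- The deviation of the path from the line of slope `ρ`. -/
noncomputable def dev (ρ : ℝ) (s : ℕ → ℤ) (i : ℕ) : ℝ := ht s i - ρ * i

/-- One plus the distance of two indices. -/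
noncomputable def gap (i j : ℕ) : ℝ := |(i : ℝ) - j| + 1

theorem gap_pos (i j : ℕ) : 0 < gap i j := by unfold gap; positivity

theorem gap_comm (i j : ℕ) : gap i j = gap j i := by unfold gap; rw [abs_sub_comm]

theorem gap_of_le {i j : ℕ} (h : i ≤ j) : gap i j = j - i + 1 := by
  unfold gap
  have : (i : ℝ) ≤ j := by exact_mod_cast h
  rw [abs_sub_comm, abs_of_nonneg (by linarith)]

theorem gap_shift (u i j : ℕ) : gap (u + i) (u + j) = gap i j := by
  unfold gap; push_cast; congr 2; ring

/-- Gaps are integers. Close pairs are handled by the absolute bound on `kern`, far pairs by the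
comparability of gap and true distance in `gap_le_three_mul`. -/
theorem gap_le_two_or (i j : ℕ) : gap i j ≤ 2 ∨ 3 ≤ gap i j := by
  rcases le_total i j with h | h
  · rw [gap_of_le h]
    rcases Nat.lt_or_ge j (i + 2) with h' | h'
    · left
      have : (j : ℝ) ≤ i + 1 := by exact_mod_cast Nat.lt_succ_iff.1 h'
      linarith
    · right
      have : (i : ℝ) + 2 ≤ j := by exact_mod_cast h'
      linarith
  · rw [gap_comm, gap_of_le h]
    rcases Nat.lt_or_ge i (j + 2) with h' | h'
    · left
      have : (i : ℝ) ≤ j + 1 := by exact_mod_cast Nat.lt_succ_iff.1 h'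
      linarith
    · right
      have : (j : ℝ) + 2 ≤ i := by exact_mod_cast h'
      linarith

theorem abs_sub_add_le_gap (i j : ℕ) {a b : ℝ} (hb : b ∈ Set.Icc (0 : ℝ) 1)
    (ha : a ∈ Set.Icc (0 : ℝ) 1) : |(i : ℝ) - j + a - b| ≤ gap i j := by
  have h1 : |a - b| ≤ 1 := abs_le.2 ⟨by linarith [ha.1, hb.2], by linarith [ha.2, hb.1]⟩
  calc _ = |((i : ℝ) - j) + (a - b)| := by congr 1; ring
    _ ≤ _ := (abs_add_le _ _).trans (by unfold gap; linarith)

theorem gap_le_three_mul (i j : ℕ) (h : 3 ≤ gap i j) {a b : ℝ} (hb : b ∈ Set.Icc (0 : ℝ) 1)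
    (ha : a ∈ Set.Icc (0 : ℝ) 1) : gap i j ≤ 3 * |(i : ℝ) - j + a - b| := by
  have h1 : |a - b| ≤ 1 := abs_le.2 ⟨by linarith [ha.1, hb.2], by linarith [ha.2, hb.1]⟩
  have h2 : |(i : ℝ) - j| ≤ |(i : ℝ) - j + a - b| + |a - b| := by
    calc _ = |((i : ℝ) - j + a - b) - (a - b)| := by congr 1; ring
      _ ≤ _ := abs_sub _ _
  unfold gap at *
  linarith

theorem slope_dev_sq_le (hρ : |ρ| ≤ 1) (hs : IsStep s) (i j : ℕ) {a b : ℝ}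
    (hb : b ∈ Set.Icc (0 : ℝ) 1) (ha : a ∈ Set.Icc (0 : ℝ) 1) :
    (a * ((s i : ℝ) - ρ) - b * (s j - ρ)) ^ 2 ≤ 16 := by
  have e : ∀ k, |(s k : ℝ) - ρ| ≤ 2 := fun k =>
    (abs_sub _ _).trans (by rw [hs.abs_cast]; linarith)
  have e' : ∀ k, ∀ c ∈ Set.Icc (0 : ℝ) 1, |c * ((s k : ℝ) - ρ)| ≤ 2 := fun k c hc => by
    rw [abs_mul, abs_of_nonneg hc.1]
    exact (mul_le_of_le_one_left (abs_nonneg _) hc.2).trans (e k)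
  have := (abs_sub (a * ((s i : ℝ) - ρ)) (b * (s j - ρ))).trans
    (add_le_add (e' i a ha) (e' j b hb))
  rw [← sq_abs]
  calc _ ≤ ((2 : ℝ) + 2) ^ 2 := by gcongr
    _ = 16 := by norm_num

theorem sub_sq_le (x y : ℝ) : (x - y) ^ 2 ≤ 2 * (x ^ 2 + y ^ 2) := by
  linarith [sq_nonneg (x + y), show (x + y) ^ 2 = x ^ 2 + y ^ 2 + 2 * (x * y) by ring,
    show (x - y) ^ 2 = x ^ 2 + y ^ 2 - 2 * (x * y) by ring]

/-- For far pairs `288 = 9 * 2 * 16`: the squared comparison of gap and distance, the square of a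
sum, and `slope_dev_sq_le` for the variation inside the two intervals. The converse estimate is
`dev_sub_sq_le`. -/
theorem W_le (hρ : |ρ| ≤ 1) (hs : IsStep s) (i j : ℕ) :
    W ρ s i j ≤ 288 * (1 + (dev ρ s i - dev ρ s j) ^ 2) / gap i j ^ 2 := by
  refine W_le_of_kern_le hρ hs i j fun b hb a ha => ?_
  have hg := gap_pos i j
  rw [le_div_iff₀ (by positivity)]
  rcases gap_le_two_or i j with h | h
  · have h4 := kern_le_four hρ hs i j hb ha
    have h0 := kern_nonneg ρ ((i : ℝ) - j) ((ht s i : ℝ) - ht s j) (s i) (s j) b a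
    have : gap i j ^ 2 ≤ 4 := by nlinarith
    nlinarith [sq_nonneg (dev ρ s i - dev ρ s j)]
  · have h3 := gap_le_three_mul i j h hb ha
    set X := (i : ℝ) - j + a - b with hX
    set N := (ht s i : ℝ) - ht s j + a * s i - b * s j with hN
    have hX0 : X ≠ 0 := by
      intro h0; rw [h0] at h3; simp at h3; linarith
    have hk : kern ρ ((i : ℝ) - j) ((ht s i : ℝ) - ht s j) (s i) (s j) b a * X ^ 2
        = (N - ρ * X) ^ 2 := by
      unfold kern
      rw [← hX, ← hN]
      field_simp
    have hsq : gap i j ^ 2 ≤ 9 * X ^ 2 := by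
      rw [← sq_abs X]
      nlinarith [abs_nonneg X]
    have hdev : N - ρ * X = (dev ρ s i - dev ρ s j) + (a * (s i - ρ) - b * (s j - ρ)) := by
      rw [hN, hX]; unfold dev; ring
    have hr2 := slope_dev_sq_le hρ hs i j hb ha
    have h0 := kern_nonneg ρ ((i : ℝ) - j) ((ht s i : ℝ) - ht s j) (s i) (s j) b a
    calc _ ≤ kern ρ ((i : ℝ) - j) ((ht s i : ℝ) - ht s j) (s i) (s j) b a * (9 * X ^ 2) := by
            gcongr
      _ = 9 * (N - ρ * X) ^ 2 := by rw [← hk]; ring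
      _ ≤ _ := by
        rw [hdev]
        linarith [add_sq_le (a := dev ρ s i - dev ρ s j)
          (b := a * ((s i : ℝ) - ρ) - b * (s j - ρ)), sq_nonneg (dev ρ s i - dev ρ s j)]

theorem dev_sub_sq_le (hρ : |ρ| ≤ 1) (hs : IsStep s) (i j : ℕ) :
    (dev ρ s i - dev ρ s j) ^ 2 ≤ 2 * gap i j ^ 2 * W ρ s i j + 32 := by
  have := unit_integral_le (A := 2 * gap i j ^ 2) (B := 32)
    (k := fun _ _ => (dev ρ s i - dev ρ s j) ^ 2) measurable_const
    (measurable_kern ρ ((i : ℝ) - j) ((ht s i : ℝ) - ht s j) (s i) (s j))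
    (M := |(dev ρ s i - dev ρ s j) ^ 2|) (fun _ _ _ _ => le_rfl) (abs_kern_le_four hρ hs i j) ?_
  · simpa [W] using this
  intro b hb a ha
  have h3 := abs_sub_add_le_gap i j hb ha
  have hN0 := hs.abs_increment_le i j ha hb
  set X := (i : ℝ) - j + a - b with hX
  set N := (ht s i : ℝ) - ht s j + a * s i - b * s j with hN
  have h0 := kern_nonneg ρ ((i : ℝ) - j) ((ht s i : ℝ) - ht s j) (s i) (s j) b a
  have hk : (N - ρ * X) ^ 2
      ≤ gap i j ^ 2 * kern ρ ((i : ℝ) - j) ((ht s i : ℝ) - ht s j) (s i) (s j) b a := by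
    -- At `X = 0` the kernel is the junk value `ρ ^ 2`; the Lipschitz bound forces `N = 0`, so the
    -- left side vanishes.
    rcases eq_or_ne X 0 with h | h
    · rw [h] at hN0
      have : N = 0 := by simpa using hN0
      rw [h, this, mul_zero, sub_zero, zero_pow two_ne_zero]
      exact mul_nonneg (sq_nonneg _) h0
    · have : (N - ρ * X) ^ 2
          = X ^ 2 * kern ρ ((i : ℝ) - j) ((ht s i : ℝ) - ht s j) (s i) (s j) b a := by
        unfold kern
        rw [← hX, ← hN]
        field_simp
      rw [this, ← sq_abs X]
      gcongr
  have hdev : dev ρ s i - dev ρ s j = (N - ρ * X) - (a * (s i - ρ) - b * (s j - ρ)) := by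
    rw [hN, hX]; unfold dev; ring
  have hr2 := slope_dev_sq_le hρ hs i j hb ha
  rw [hdev]
  linarith [sub_sq_le (N - ρ * X) (a * ((s i : ℝ) - ρ) - b * (s j - ρ))]

/-! ### Stability of the interaction under nearly affine changes of the path. -/

theorem abs_convex_le {a x y M : ℝ} (ha : a ∈ Set.Icc (0 : ℝ) 1) (hx : |x| ≤ M) (hy : |y| ≤ M) :
    |(1 - a) * x + a * y| ≤ M := by
  refine (abs_add_le _ _).trans ?_
  rw [abs_mul, abs_mul, abs_of_nonneg ha.1, abs_of_nonneg (by linarith [ha.2] : 0 ≤ 1 - a)]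
  nlinarith [ha.1, ha.2]

/-- Serves close pairs, where `ε` is a rounding error divided by a possibly tiny distance. Then `ε`
is bounded only as the difference of two deviations of slope, each at most 2. -/
theorem abs_le_of_sq_add_le {κ A β ε : ℝ} (hκ0 : 0 ≤ κ) (hA : A ^ 2 ≤ 4)
    (h : (κ * A + β + ε) ^ 2 ≤ 4) (hβ : |β| ≤ 2 * (1 - κ)) : |ε| ≤ 4 := by
  have hA2 : |A| ≤ 2 := abs_le_of_sq_le_sq (by linarith) (by norm_num)
  have hA2' : |κ * A + β + ε| ≤ 2 := abs_le_of_sq_le_sq (by linarith) (by norm_num)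
  have hκA : |κ * A| ≤ 2 * κ := by
    rw [abs_mul, abs_of_nonneg hκ0]
    nlinarith
  calc |ε| = |(κ * A + β + ε) - κ * A - β| := by congr 1; ring
    _ ≤ |κ * A + β + ε| + |κ * A| + |β| :=
      (abs_sub _ _).trans (by linarith [abs_sub (κ * A + β + ε) (κ * A)])
    _ ≤ 4 := by linarith

/-- Young's inequality with separate parameters for the two perturbations: `l`, for the change of
slope `β`, will depend on the pair of indices, while `m`, for the rounding error `ε`, will be
constant. -/
theorem sq_perturb_le {κ l m : ℝ} (hκ0 : 0 ≤ κ) (hκ1 : κ ≤ 1) (hl : 0 < l) (hl1 : l ≤ 1)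
    (hm : 0 < m) (hm1 : m ≤ 1) (A β ε : ℝ) :
    (κ * A + β + ε) ^ 2 ≤ (1 + (l + m)) * A ^ 2 + (3 * β ^ 2 / l + 3 * ε ^ 2 / m) := by
  have hκA : (κ * A) ^ 2 ≤ A ^ 2 := by
    rw [mul_pow]; nlinarith [sq_nonneg A, pow_le_one₀ hκ0 hκ1 (n := 2)]
  generalize κ * A = P at *
  have i1 : 2 * (P * β) ≤ l * P ^ 2 + β ^ 2 / l := by
    have : 0 ≤ (l * P - β) ^ 2 / l := by positivity
    have e : (l * P - β) ^ 2 / l = l * P ^ 2 - 2 * (P * β) + β ^ 2 / l := by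
      field_simp; ring
    linarith
  have i2 : 2 * (P * ε) ≤ m * P ^ 2 + ε ^ 2 / m := by
    have : 0 ≤ (m * P - ε) ^ 2 / m := by positivity
    have e : (m * P - ε) ^ 2 / m = m * P ^ 2 - 2 * (P * ε) + ε ^ 2 / m := by
      field_simp; ring
    linarith
  have i3 : β ^ 2 ≤ β ^ 2 / l := by
    rw [le_div_iff₀ hl]; nlinarith [sq_nonneg β]
  have i4 : ε ^ 2 ≤ ε ^ 2 / m := by
    rw [le_div_iff₀ hm]; nlinarith [sq_nonneg ε]
  have i7 : 3 * β ^ 2 / l = 3 * (β ^ 2 / l) := by ring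
  have i7' : 3 * ε ^ 2 / m = 3 * (ε ^ 2 / m) := by ring
  have i8 : (1 + l + m) * P ^ 2 ≤ (1 + l + m) * A ^ 2 := by gcongr
  rw [i7, i7']
  have i9 : (P + β + ε) ^ 2 = P ^ 2 + β ^ 2 + ε ^ 2 + 2 * (P * β) + 2 * (P * ε) + 2 * (β * ε) := by
    ring
  linarith [sq_nonneg (β - ε), show (β - ε) ^ 2 = β ^ 2 + ε ^ 2 - 2 * (β * ε) by ring,
    show (1 + l + m) * P ^ 2 = P ^ 2 + l * P ^ 2 + m * P ^ 2 by ring,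
    show (1 + (l + m)) * A ^ 2 = (1 + l + m) * A ^ 2 by ring]

/-- Comparison of the interactions of a path and of a nearly affine image of it. -/
theorem W_perturb (hρ : |ρ| ≤ 1) (hs : IsStep s) {s' : ℕ → ℤ} (hs' : IsStep s') {κ c : ℝ}
    {e : ℕ → ℝ} (hκ0 : 0 ≤ κ) (hκ1 : κ ≤ 1) (hc : |c| ≤ 1 - κ) {i j : ℕ}
    (he : ∀ k, k = i ∨ k = i + 1 ∨ k = j ∨ k = j + 1 →
      |e k| ≤ 2 ∧ (ht s' k : ℝ) = κ * ht s k + c * k + e k)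
    {l m : ℝ} (hl : 0 < l) (hl1 : l ≤ 1) (hm : 0 < m) (hm1 : m ≤ 1) :
    W ρ s' i j ≤ (1 + l + m) * W ρ s i j + 3 * (c - (1 - κ) * ρ) ^ 2 / l
      + 432 / m / gap i j ^ 2 := by
  rw [add_assoc]
  refine unit_integral_le (measurable_kern _ _ _ _ _) (measurable_kern _ _ _ _ _)
    (abs_kern_le_four hρ hs' i j) (abs_kern_le_four hρ hs i j) ?_
  intro b hb a ha
  have h4 := kern_le_four hρ hs i j hb ha
  have h4' := kern_le_four hρ hs' i j hb ha
  unfold kern at *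
  set X := (i : ℝ) - j + a - b with hX
  obtain ⟨he1, hi⟩ := he i (by simp)
  obtain ⟨he2, hi'⟩ := he (i + 1) (by simp)
  obtain ⟨he3, hj⟩ := he j (by simp)
  obtain ⟨he4, hj'⟩ := he (j + 1) (by simp)
  have hsi : (s' i : ℝ) = κ * s i + c + (e (i + 1) - e i) := by
    have h1 : (ht s' (i + 1) : ℝ) = ht s' i + s' i := by rw [ht_succ]; push_cast; ring
    have h2 : (ht s (i + 1) : ℝ) = ht s i + s i := by rw [ht_succ]; push_cast; ring
    rw [h1, h2, hi] at hi'
    push_cast at hi'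
    linarith
  have hsj : (s' j : ℝ) = κ * s j + c + (e (j + 1) - e j) := by
    have h1 : (ht s' (j + 1) : ℝ) = ht s' j + s' j := by rw [ht_succ]; push_cast; ring
    have h2 : (ht s (j + 1) : ℝ) = ht s j + s j := by rw [ht_succ]; push_cast; ring
    rw [h1, h2, hj] at hj'
    push_cast at hj'
    linarith
  set N := (ht s i : ℝ) - ht s j + a * s i - b * s j with hN
  set N' := (ht s' i : ℝ) - ht s' j + a * s' i - b * s' j with hN'
  set η := (1 - a) * e i + a * e (i + 1) - ((1 - b) * e j + b * e (j + 1)) with hη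
  have hNN : N' = κ * N + c * X + η := by
    rw [hN', hN, hX, hη, hi, hj, hsi, hsj]; ring
  have hη4 : |η| ≤ 4 := by
    refine (abs_sub _ _).trans ?_
    linarith [abs_convex_le ha he1 he2, abs_convex_le hb he3 he4]
  have hg := gap_pos i j
  -- At `X = 0` both kernels equal `ρ ^ 2`.
  rcases eq_or_ne X 0 with hX0 | hX0
  · rw [hX0]
    simp only [div_zero, zero_sub, even_two, Even.neg_pow]
    have h1 : 0 ≤ 3 * (c - (1 - κ) * ρ) ^ 2 / l := by positivity
    have h2 : 0 ≤ 432 / m / gap i j ^ 2 := by positivity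
    linarith [mul_nonneg (add_nonneg hl.le hm.le) (sq_nonneg ρ),
      show (1 + (l + m)) * ρ ^ 2 = ρ ^ 2 + (l + m) * ρ ^ 2 by ring]
  set A := N / X - ρ with hA
  set β := c - (1 - κ) * ρ with hβ
  set ε := η / X with hε
  have hA' : N' / X - ρ = κ * A + β + ε := by
    rw [hNN, hA, hβ, hε]; field_simp; ring
  -- Close pairs give `4 * gap ≤ 8`; far pairs give `|η| * gap ≤ 4 * 3 * |X|`.
  have hε1 : |ε| ≤ 12 / gap i j := by
    rw [le_div_iff₀ hg]
    rcases gap_le_two_or i j with h | h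
    · rw [hA'] at h4'
      have hβ2 : |β| ≤ 2 * (1 - κ) := by
        refine (abs_sub _ _).trans ?_
        rw [abs_mul, abs_of_nonneg (by linarith : 0 ≤ 1 - κ)]
        linarith [mul_le_mul_of_nonneg_left hρ (by linarith : 0 ≤ 1 - κ)]
      have := abs_le_of_sq_add_le hκ0 h4 h4' hβ2
      calc |ε| * gap i j ≤ 4 * 2 + 4 := by
            linarith [mul_le_mul this h hg.le (by norm_num : (0 : ℝ) ≤ 4)]
        _ = 12 := by norm_num
    · have h3 := gap_le_three_mul i j h hb ha
      rw [← hX] at h3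
      rw [hε, abs_div]
      have hXp : 0 < |X| := abs_pos.2 hX0
      rw [div_mul_eq_mul_div, div_le_iff₀ hXp]
      calc |η| * gap i j ≤ 4 * (3 * |X|) := mul_le_mul hη4 h3 hg.le (by norm_num)
        _ = 12 * |X| := by ring
  have hε2 : ε ^ 2 ≤ 144 / gap i j ^ 2 := by
    rw [← sq_abs]
    calc |ε| ^ 2 ≤ (12 / gap i j) ^ 2 := by gcongr
      _ = _ := by rw [div_pow]; norm_num
  rw [hA']
  refine (sq_perturb_le hκ0 hκ1 hl hl1 hm hm1 A β ε).trans ?_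
  have i5 : ε ^ 2 / m ≤ 144 / gap i j ^ 2 / m := by gcongr
  have i6 : 432 / m / gap i j ^ 2 = 3 * (144 / gap i j ^ 2 / m) := by
    field_simp; norm_num
  have i7 : 3 * ε ^ 2 / m = 3 * (ε ^ 2 / m) := by ring
  rw [i6, i7]
  linarith

end LocalOpt

namespace LocalOpt

open Finset

/-! ### The energy of a step sequence -/

/-- Each term is at most `1 / ((k + 1) (k + 2))` times `1 / x ^ 2`, and these bounds telescope. -/
theorem phi_term_sum_le {x : ℝ} (hx : 1 ≤ x) (m : ℕ) :
    ∑ k ∈ range m, 1 / (((k : ℝ) + 1) * ((k : ℝ) + 2) * (2 * (k : ℝ) + 3) * x ^ (2 * (k + 1)))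
      ≤ (1 - 1 / ((m : ℝ) + 1)) * (1 / x ^ 2) := by
  induction m with
  | zero => simp
  | succ m ih =>
    rw [sum_range_succ]
    have hx2 : x ^ 2 ≤ x ^ (2 * (m + 1)) := pow_le_pow_right₀ hx (by omega)
    have h1 : 1 / (((m : ℝ) + 1) * ((m : ℝ) + 2) * (2 * (m : ℝ) + 3) * x ^ (2 * (m + 1)))
        ≤ 1 / (((m : ℝ) + 1) * ((m : ℝ) + 2)) * (1 / x ^ 2) := by
      rw [one_div_mul_one_div]
      apply one_div_le_one_div_of_le (by positivity)
      have hm : (0 : ℝ) ≤ m := m.cast_nonneg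
      calc ((m : ℝ) + 1) * (m + 2) * x ^ 2 ≤ ((m : ℝ) + 1) * (m + 2) * x ^ (2 * (m + 1)) := by
            gcongr
        _ = ((m : ℝ) + 1) * (m + 2) * 1 * x ^ (2 * (m + 1)) := by ring
        _ ≤ _ := by gcongr; linarith
    have h2 : (1 - 1 / ((m : ℝ) + 1)) + 1 / (((m : ℝ) + 1) * ((m : ℝ) + 2))
        = 1 - 1 / ((m : ℝ) + 1 + 1) := by
      field_simp; ring
    push_cast
    calc _ ≤ (1 - 1 / ((m : ℝ) + 1)) * (1 / x ^ 2)
          + 1 / (((m : ℝ) + 1) * ((m : ℝ) + 2)) * (1 / x ^ 2) := add_le_add ih h1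
      _ = _ := by rw [← add_mul, h2]

theorem phi_nonneg {x : ℝ} (hx : 1 ≤ x) : 0 ≤ phi x :=
  tsum_nonneg fun k => by positivity

theorem phi_le {x : ℝ} (hx : 1 ≤ x) : phi x ≤ 1 / x ^ 2 := by
  refine Real.tsum_le_of_sum_range_le (fun k => by positivity) fun m =>
    (phi_term_sum_le hx m).trans ?_
  have : (0 : ℝ) ≤ 1 / ((m : ℝ) + 1) := by positivity
  exact mul_le_of_le_one_left (by positivity) (by linarith)

/-- The contribution of an up-step `i` and of a down-step `j` to the hook sum. -/
noncomputable def hk (s : ℕ → ℤ) (i j : ℕ) : ℝ :=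
  if i < j ∧ s i = 1 ∧ s j = -1 then phi ((j - i : ℕ) : ℝ) else 0

/-- The contribution of two steps to the energy. -/
noncomputable def pair (ρ : ℝ) (s : ℕ → ℤ) (i j : ℕ) : ℝ := 1 / 8 * W ρ s i j + hk s i j

/-- The energy of the first `n` steps. -/
noncomputable def E (ρ : ℝ) (s : ℕ → ℤ) (n : ℕ) : ℝ :=
  ∑ i ∈ range n, ∑ j ∈ range n, pair ρ s i j

theorem one_le_cast_sub {i j : ℕ} (h : i < j) : (1 : ℝ) ≤ ((j - i : ℕ) : ℝ) := by
  exact_mod_cast Nat.sub_pos_of_lt h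

theorem hk_nonneg (s : ℕ → ℤ) (i j : ℕ) : 0 ≤ hk s i j := by
  unfold hk
  split_ifs with h
  · exact phi_nonneg (one_le_cast_sub h.1)
  · exact le_rfl

theorem phi_sub_le {i j : ℕ} (h : i < j) : phi ((j - i : ℕ) : ℝ) ≤ 4 / gap i j ^ 2 := by
  have h1 := one_le_cast_sub h
  refine (phi_le h1).trans ?_
  rw [gap_of_le h.le, ← Nat.cast_sub h.le, div_le_div_iff₀ (by positivity) (by positivity)]
  nlinarith

theorem hk_le (s : ℕ → ℤ) (i j : ℕ) : hk s i j ≤ 4 / gap i j ^ 2 := by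
  unfold hk
  split_ifs with h
  · exact phi_sub_le h.1
  · positivity

variable {ρ : ℝ} {s : ℕ → ℤ}

theorem pair_nonneg (ρ : ℝ) (s : ℕ → ℤ) (i j : ℕ) : 0 ≤ pair ρ s i j :=
  add_nonneg (mul_nonneg (by norm_num) (W_nonneg _ _ _ _)) (hk_nonneg _ _ _)

theorem W_le_pair (ρ : ℝ) (s : ℕ → ℤ) (i j : ℕ) : W ρ s i j ≤ 8 * pair ρ s i j := by
  unfold pair
  linarith [hk_nonneg s i j]

/-- The constant is `288 / 8 + 4`, from `W_le` and `hk_le`. -/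
theorem pair_le (hρ : |ρ| ≤ 1) (hs : IsStep s) (i j : ℕ) :
    pair ρ s i j ≤ 40 * (1 + (dev ρ s i - dev ρ s j) ^ 2) / gap i j ^ 2 := by
  have h1 := W_le hρ hs i j
  have h2 := hk_le s i j
  have hg := gap_pos i j
  unfold pair
  rw [le_div_iff₀ (by positivity)] at h1 h2 ⊢
  nlinarith [sq_nonneg (dev ρ s i - dev ρ s j)]

theorem W_congr {s' : ℕ → ℤ} {i j i' j' : ℕ} (h : ht s i - ht s j = ht s' i' - ht s' j')
    (hij : (i : ℝ) - j = i' - j') (hi : s i = s' i') (hj : s j = s' j') :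
    W ρ s i j = W ρ s' i' j' := by
  have h' : (ht s i : ℝ) - ht s j = ht s' i' - ht s' j' := by exact_mod_cast h
  unfold W
  rw [h', hij, hi, hj]

theorem W_shift (u i j : ℕ) : W ρ (fun t => s (u + t)) i j = W ρ s (u + i) (u + j) :=
  W_congr (by rw [ht_shift, ht_shift]; ring) (by push_cast; ring) rfl rfl

theorem hk_shift (u i j : ℕ) : hk (fun t => s (u + t)) i j = hk s (u + i) (u + j) := by
  unfold hk
  rw [Nat.add_sub_add_left]
  simp

theorem pair_shift (u i j : ℕ) : pair ρ (fun t => s (u + t)) i j = pair ρ s (u + i) (u + j) := by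
  unfold pair
  rw [W_shift, hk_shift]

theorem ht_congr {s' : ℕ → ℤ} {n i : ℕ} (h : ∀ t < n, s t = s' t) (hi : i ≤ n) :
    ht s i = ht s' i :=
  sum_congr rfl fun t ht => h t (lt_of_lt_of_le (mem_range.1 ht) hi)

theorem pair_congr {s' : ℕ → ℤ} {n i j : ℕ} (h : ∀ t < n, s t = s' t) (hi : i < n) (hj : j < n) :
    pair ρ s i j = pair ρ s' i j := by
  unfold pair hk
  rw [W_congr (by rw [ht_congr h hi.le, ht_congr h hj.le]) rfl (h i hi) (h j hj), h i hi, h j hj]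

theorem E_congr {s' : ℕ → ℤ} {n : ℕ} (h : ∀ t < n, s t = s' t) : E ρ s n = E ρ s' n :=
  sum_congr rfl fun _ hi => sum_congr rfl fun _ hj =>
    pair_congr h (mem_range.1 hi) (mem_range.1 hj)

theorem E_nonneg (ρ : ℝ) (s : ℕ → ℤ) (n : ℕ) : 0 ≤ E ρ s n :=
  sum_nonneg fun _ _ => sum_nonneg fun _ _ => pair_nonneg _ _ _ _

/-! ### Splitting the energy, and sums over windows. -/

theorem E_add (ρ : ℝ) (s : ℕ → ℤ) (m n : ℕ) :
    E ρ s (m + n) = E ρ s m + E ρ (fun t => s (m + t)) n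
      + ∑ i ∈ range m, ∑ j ∈ range n, (pair ρ s i (m + j) + pair ρ s (m + j) i) := by
  unfold E
  simp only [pair_shift, sum_range_add, sum_add_distrib]
  rw [sum_comm (s := range m) (t := range n) (f := fun i j => pair ρ s (m + j) i)]
  ring

theorem E_superadd (ρ : ℝ) (s : ℕ → ℤ) (m n : ℕ) :
    E ρ s m + E ρ (fun t => s (m + t)) n ≤ E ρ s (m + n) := by
  rw [E_add]
  exact le_add_of_nonneg_right <| sum_nonneg fun _ _ => sum_nonneg fun _ _ =>
    add_nonneg (pair_nonneg _ _ _ _) (pair_nonneg _ _ _ _)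

/-- A row of a window is part of a row of the whole array. -/
theorem sum_shift_le {c : ℕ → ℝ} (hc : ∀ a, 0 ≤ c a) {u L n : ℕ} (h : u + L ≤ n) :
    ∑ j ∈ range L, c (u + j) ≤ ∑ b ∈ range n, c b := by
  have : ∑ j ∈ range L, c (u + j) = ∑ b ∈ (range L).map (addLeftEmbedding u), c b := by
    simp [sum_map]
  rw [this]
  refine sum_le_sum_of_subset_of_nonneg ?_ fun _ _ _ => hc _
  intro b
  simp only [mem_map, mem_range, addLeftEmbedding_apply]
  rintro ⟨j, hj, rfl⟩
  omega

/-- Every pair of indices lies in at most `L` windows of length `L`. -/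
theorem sum_windows_le {c : ℕ → ℕ → ℝ} (hc : ∀ a b, 0 ≤ c a b) {K L n : ℕ} (h : K + L ≤ n + 1) :
    ∑ u ∈ range K, ∑ i ∈ range L, ∑ j ∈ range L, c (u + i) (u + j)
      ≤ L * ∑ a ∈ range n, ∑ b ∈ range n, c a b := by
  rw [sum_comm]
  -- With the offset `i` inside the window fixed, distinct windows use distinct rows; the `L`
  -- offsets give the factor `L`.
  have key : ∀ i ∈ range L, ∑ u ∈ range K, ∑ j ∈ range L, c (u + i) (u + j)
      ≤ ∑ a ∈ range n, ∑ b ∈ range n, c a b := by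
    intro i hi
    have hi' := mem_range.1 hi
    calc _ ≤ ∑ u ∈ range K, ∑ b ∈ range n, c (i + u) b := by
          refine sum_le_sum fun u hu => ?_
          rw [add_comm i u]
          have := mem_range.1 hu
          exact sum_shift_le (c := c (u + i)) (fun _ => hc _ _) (by omega)
      _ ≤ _ := sum_shift_le (c := fun a => ∑ b ∈ range n, c a b)
          (fun _ => sum_nonneg fun _ _ => hc _ _) (by omega)
  exact (sum_le_sum key).trans (by simp)

end LocalOpt

namespace LocalOpt

open Finset

/-! ### From functions to step sequences -/

/-- `f` is on `[0, n]` the piecewise linear function with steps `s`. -/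
def Follows (n : ℕ) (s : ℕ → ℤ) (f : ℝ → ℝ) : Prop :=
  ∀ i < n, ∀ a ∈ Set.Icc (0 : ℝ) 1, f (i + a) = ht s i + a * s i

theorem notMem_range_intCast {i : ℕ} {x : ℝ} (h1 : (i : ℝ) < x) (h2 : x < i + 1) :
    x ∉ Set.range (Int.cast : ℤ → ℝ) := by
  rintro ⟨z, rfl⟩
  have h3 : (i : ℤ) < z := by exact_mod_cast h1
  have h4 : z < (i : ℤ) + 1 := by exact_mod_cast h2
  omega

theorem affine_of_hasDerivAt {f : ℝ → ℝ} {p v : ℝ} (hc : ContinuousOn f (Set.Icc p (p + 1)))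
    (hv : ∀ x ∈ Set.Ioo p (p + 1), HasDerivAt f v x) :
    ∀ a ∈ Set.Icc (0 : ℝ) 1, f (p + a) = f p + a * v := by
  intro a ha
  rcases ha.1.eq_or_lt with rfl | ha0
  · simp
  · obtain ⟨c, _, h⟩ := exists_hasDerivAt_eq_slope f (fun _ => v) (a := p) (b := p + a)
      (by linarith) (hc.mono (Set.Icc_subset_Icc_right (by linarith [ha.2])))
      fun x hx => hv x ⟨hx.1, hx.2.trans_le (by linarith [ha.2])⟩
    rw [add_sub_cancel_left, eq_div_iff ha0.ne'] at h
    linarith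

/-- A function with derivative `1` or `-1` everywhere inside an interval is affine there. -/
theorem exists_slope {f : ℝ → ℝ} {p : ℝ} (hc : ContinuousOn f (Set.Icc p (p + 1)))
    (hd : ∀ x ∈ Set.Ioo p (p + 1), HasDerivAt f 1 x ∨ HasDerivAt f (-1) x) :
    ∃ z : ℤ, (z = 1 ∨ z = -1) ∧ ∀ a ∈ Set.Icc (0 : ℝ) 1, f (p + a) = f p + a * z := by
  have hd' : ∀ x ∈ Set.Ioo p (p + 1), HasDerivAt f (deriv f x) x ∧ (deriv f x = 1 ∨ deriv f x = -1) := by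
    intro x hx
    rcases hd x hx with h | h <;> rw [h.deriv] <;> simp [h]
  -- Darboux: a derivative that avoids 0 on an interval has constant sign there.
  rcases hasDerivWithinAt_forall_lt_or_forall_gt_of_forall_ne (convex_Ioo p (p + 1))
    (fun x hx => (hd' x hx).1.hasDerivWithinAt) (m := 0)
    (fun x hx => by rcases (hd' x hx).2 with h | h <;> rw [h] <;> norm_num) with h | h
  · refine ⟨-1, Or.inr rfl, affine_of_hasDerivAt hc fun x hx => ?_⟩
    obtain ⟨h1, h2⟩ := hd' x hx
    have h3 := h x hx
    rcases h2 with h2 | h2 <;> rw [h2] at h1 h3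
    · norm_num at h3
    · simpa using h1
  · refine ⟨1, Or.inl rfl, affine_of_hasDerivAt hc fun x hx => ?_⟩
    obtain ⟨h1, h2⟩ := hd' x hx
    have h3 := h x hx
    rcases h2 with h2 | h2 <;> rw [h2] at h1 h3
    · simpa using h1
    · norm_num at h3

theorem exists_follows {n : ℕ} {f : ℝ → ℝ} (hf : f ∈ Sloc n) : ∃ s, IsStep s ∧ Follows n s f := by
  obtain ⟨hc, h0, hd⟩ := hf
  have key : ∀ i : ℕ, ∃ z : ℤ, (z = 1 ∨ z = -1) ∧
      (i < n → ∀ a ∈ Set.Icc (0 : ℝ) 1, f (i + a) = f i + a * z) := by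
    intro i
    by_cases hi : i < n
    · have hi' : (i : ℝ) + 1 ≤ n := by exact_mod_cast hi
      have hi0 : (0 : ℝ) ≤ i := i.cast_nonneg
      obtain ⟨z, hz, h⟩ := exists_slope (f := f) (p := i)
        (hc.mono (Set.Icc_subset_Icc hi0 hi')) fun x hx =>
          hd x ⟨hi0.trans_lt hx.1, hx.2.trans_le hi'⟩ (notMem_range_intCast hx.1 hx.2)
      exact ⟨z, hz, fun _ => h⟩
    · exact ⟨1, Or.inl rfl, fun h => absurd h hi⟩
  choose s hs h using key
  have hht : ∀ i ≤ n, f i = ht s i := by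
    intro i
    induction i with
    | zero => simp [h0, ht_zero]
    | succ i ih =>
      intro hi
      have := h i hi 1 (by simp)
      rw [ih (by omega)] at this
      rw [ht_succ]
      push_cast
      rw [this, one_mul]
  exact ⟨s, hs, fun i hi a ha => by rw [h i hi a ha, hht i hi.le]⟩

/-- The function with steps `s` on `[0, n]`, constant outside. -/
noncomputable def path (s : ℕ → ℤ) (n : ℕ) (x : ℝ) : ℝ :=
  ∑ t ∈ range n, s t * max 0 (min 1 (x - t))

theorem continuous_path (s : ℕ → ℤ) (n : ℕ) : Continuous (path s n) := by
  unfold path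
  fun_prop

theorem follows_path (s : ℕ → ℤ) (n : ℕ) : Follows n s (path s n) := by
  intro i hi a ha
  obtain ⟨k, rfl⟩ := Nat.exists_eq_add_of_lt hi
  unfold path
  rw [add_assoc, sum_range_add, sum_range_succ', ht]
  have h1 : ∑ t ∈ range i, (s t : ℝ) * max 0 (min 1 (i + a - t)) = ∑ t ∈ range i, (s t : ℝ) := by
    refine sum_congr rfl fun t ht => ?_
    have : (t : ℝ) + 1 ≤ i := by exact_mod_cast mem_range.1 ht
    rw [min_eq_left (by linarith [ha.1]), max_eq_right zero_le_one, mul_one]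
  have h2 : ∑ t ∈ range k, (s (i + (t + 1)) : ℝ) * max 0 (min 1 (i + a - ((i + (t + 1) : ℕ) : ℝ)))
      = 0 := by
    refine sum_eq_zero fun t _ => ?_
    have : (0 : ℝ) ≤ t := t.cast_nonneg
    rw [max_eq_left, mul_zero]
    refine (min_le_right _ _).trans ?_
    push_cast
    linarith [ha.2]
  rw [h1, h2]
  push_cast
  simp only [add_zero, zero_add, add_sub_cancel_left]
  rw [min_eq_right ha.2, max_eq_right ha.1]
  ring

theorem sum_clamp (n : ℕ) (x : ℝ) :
    ∑ t ∈ range n, max 0 (min 1 (x - t)) = max 0 (min (n : ℝ) x) := by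
  induction n with
  | zero => simp
  | succ n ih =>
    rw [sum_range_succ, ih]
    have hn : (0 : ℝ) ≤ n := n.cast_nonneg
    push_cast
    rcases le_total x n with h | h
    · rw [min_eq_right h, min_eq_right (by linarith : x ≤ n + 1), min_eq_right (by linarith : x - n ≤ 1),
        max_eq_left (by linarith : x - n ≤ 0), add_zero]
    · rw [min_eq_left h, max_eq_right hn]
      rcases le_total x (n + 1) with h' | h'
      · rw [min_eq_right h', min_eq_right (by linarith : x - n ≤ 1), max_eq_right (by linarith),
          max_eq_right (by linarith)]
        ring
      · rw [min_eq_left h', min_eq_left (by linarith : 1 ≤ x - n), max_eq_right (by linarith),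
          max_eq_right (by linarith)]

/-- The estimate holds on the whole line, which bounds the integrand of `theta` everywhere, as
`integral_square_eq_sum` demands. -/
theorem abs_path_sub_le {s : ℕ → ℤ} (hs : IsStep s) (n : ℕ) (x y : ℝ) :
    |path s n x - path s n y| ≤ |x - y| := by
  wlog h : y ≤ x generalizing x y
  · rw [abs_sub_comm, abs_sub_comm x]
    exact this y x (le_of_not_ge h)
  have hmono : ∀ t : ℕ, max 0 (min 1 (y - t)) ≤ max 0 (min 1 (x - t)) := fun t => by gcongr
  unfold path
  rw [← sum_sub_distrib]
  calc _ ≤ ∑ t ∈ range n, |(s t : ℝ) * max 0 (min 1 (x - t)) - s t * max 0 (min 1 (y - t))| :=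
        abs_sum_le_sum_abs _ _
    _ = ∑ t ∈ range n, (max 0 (min 1 (x - t)) - max 0 (min 1 (y - t))) := by
        refine sum_congr rfl fun t _ => ?_
        rw [← mul_sub, abs_mul, hs.abs_cast, one_mul, abs_of_nonneg (sub_nonneg.2 (hmono t))]
    _ = max 0 (min (n : ℝ) x) - max 0 (min (n : ℝ) y) := by
        rw [sum_sub_distrib, sum_clamp, sum_clamp]
    _ ≤ |max 0 (min (n : ℝ) x) - max 0 (min (n : ℝ) y)| := le_abs_self _
    _ ≤ |min (n : ℝ) x - min (n : ℝ) y| := by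
        simpa using abs_max_sub_max_le_max (0 : ℝ) (min (n : ℝ) x) 0 (min (n : ℝ) y)
    _ ≤ |x - y| := by
        have := abs_min_sub_min_le_max (n : ℝ) x n y
        simpa using this

theorem path_mem_Sloc {s : ℕ → ℤ} (hs : IsStep s) (n : ℕ) : path s n ∈ Sloc n := by
  refine ⟨(continuous_path s n).continuousOn, ?_, ?_⟩
  · refine sum_eq_zero fun t _ => ?_
    have : (0 : ℝ) ≤ t := t.cast_nonneg
    rw [max_eq_left, mul_zero]
    exact (min_le_right _ _).trans (by linarith)
  · intro x hx hxz
    set i := ⌊x⌋₊ with hi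
    have h1 : (i : ℝ) ≤ x := Nat.floor_le hx.1.le
    have h2 : x < i + 1 := Nat.lt_floor_add_one x
    have h1' : (i : ℝ) < x := lt_of_le_of_ne h1 fun h => hxz ⟨i, by simpa using h⟩
    have hin : i < n := by
      have : (i : ℝ) < n := h1.trans_lt hx.2
      exact_mod_cast this
    have hd : HasDerivAt (path s n) (s i : ℝ) x := by
      have h3 : HasDerivAt (fun y : ℝ => (ht s i : ℝ) + (y - i) * s i) (s i : ℝ) x := by
        simpa using (((hasDerivAt_id x).sub_const (i : ℝ)).mul_const (s i : ℝ)).const_add (ht s i : ℝ)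
      refine h3.congr_of_eventuallyEq ?_
      filter_upwards [Ioo_mem_nhds h1' h2] with y hy
      have := follows_path s n i hin (y - i) ⟨by linarith [hy.1], by linarith [hy.2]⟩
      rwa [add_sub_cancel] at this
    rcases hs i with h | h <;> rw [h] at hd
    · left; simpa using hd
    · right; simpa using hd

theorem Follows.eqOn {n : ℕ} {s : ℕ → ℤ} {f g : ℝ → ℝ} (hf : Follows n s f) (hg : Follows n s g)
    (hn : 0 < n) : Set.EqOn f g (Set.Icc 0 (n : ℝ)) := by
  intro x hx
  have key : ∃ i < n, ∃ a ∈ Set.Icc (0 : ℝ) 1, x = i + a := by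
    rcases hx.2.eq_or_lt with h | h
    · refine ⟨n - 1, by omega, 1, by simp, ?_⟩
      rw [h, Nat.cast_sub hn]
      simp
    · have h1 := Nat.floor_le hx.1
      have h2 := Nat.lt_floor_add_one x
      refine ⟨⌊x⌋₊, ?_, x - ⌊x⌋₊, ⟨by linarith, by linarith⟩, by ring⟩
      have : (⌊x⌋₊ : ℝ) < n := h1.trans_lt h
      exact_mod_cast this
  obtain ⟨i, hi, a, ha, rfl⟩ := key
  rw [hf i hi a ha, hg i hi a ha]

theorem intervalIntegrable_of_bounded {g : ℝ → ℝ} (hg : Measurable g) {M : ℝ} (hM : ∀ x, |g x| ≤ M)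
    (p q : ℝ) : IntervalIntegrable g MeasureTheory.volume p q := by
  rw [intervalIntegrable_iff]
  refine MeasureTheory.Measure.integrableOn_of_bounded (M := M) ?_ hg.aestronglyMeasurable ?_
  · simp [Set.uIoc]
  · exact Filter.Eventually.of_forall fun x => hM x

theorem integral_square_eq_sum {Q : ℝ → ℝ → ℝ} (hQ : Measurable fun z : ℝ × ℝ => Q z.1 z.2) {M : ℝ}
    (hM : ∀ y x, |Q y x| ≤ M) (n : ℕ) :
    ∫ y in (0 : ℝ)..n, ∫ x in (0 : ℝ)..n, Q y x
      = ∑ i ∈ range n, ∑ j ∈ range n,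
        ∫ b in (0 : ℝ)..1, ∫ a in (0 : ℝ)..1, Q (j + b) (i + a) := by
  have hM' : 0 ≤ M := (abs_nonneg _).trans (hM 0 0)
  have hin : ∀ y, Measurable (Q y) := fun y => hQ.comp measurable_prodMk_left
  have split : ∀ g : ℝ → ℝ, Measurable g → ∀ M, (∀ x, |g x| ≤ M) →
      ∫ x in (0 : ℝ)..n, g x = ∑ i ∈ range n, ∫ a in (0 : ℝ)..1, g (i + a) := by
    intro g hg M hgM
    have := intervalIntegral.sum_integral_adjacent_intervals (f := g) (a := fun k : ℕ => (k : ℝ))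
      (n := n) (μ := MeasureTheory.volume)
      fun k _ => intervalIntegrable_of_bounded hg hgM _ _
    simp only [Nat.cast_zero] at this
    rw [← this]
    refine sum_congr rfl fun i _ => ?_
    rw [intervalIntegral.integral_comp_add_left (fun x => g x) (i : ℝ)]
    simp
  have hout : ∀ i : ℕ, Measurable fun y => ∫ a in (0 : ℝ)..1, Q y (i + a) := by
    intro i
    have h1 : Measurable fun z : ℝ × ℝ => Q z.1 (i + z.2) :=
      hQ.comp (measurable_fst.prodMk (measurable_snd.const_add _))
    simp only [intervalIntegral.integral_of_le (zero_le_one (α := ℝ))]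
    exact (h1.stronglyMeasurable.integral_prod_right
      (ν := MeasureTheory.volume.restrict (Set.Ioc (0 : ℝ) 1))).measurable
  have hb : ∀ (i : ℕ) y, |∫ a in (0 : ℝ)..1, Q y (i + a)| ≤ M := by
    intro i y
    have := intervalIntegral.norm_integral_le_of_norm_le_const (a := (0 : ℝ)) (b := 1) (C := M)
      (f := fun a => Q y (i + a)) fun a _ => hM y _
    simpa using this
  calc _ = ∫ y in (0 : ℝ)..n, ∑ i ∈ range n, ∫ a in (0 : ℝ)..1, Q y (i + a) := by
        refine intervalIntegral.integral_congr fun y _ => ?_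
        exact split (Q y) (hin y) M (hM y)
    _ = ∑ i ∈ range n, ∫ y in (0 : ℝ)..n, ∫ a in (0 : ℝ)..1, Q y (i + a) :=
        intervalIntegral.integral_finsetSum fun i _ =>
          intervalIntegrable_of_bounded (hout i) (hb i) _ _
    _ = _ := sum_congr rfl fun i _ => split _ (hout i) M (hb i)

theorem theta_eq {n : ℕ} {s : ℕ → ℤ} (hs : IsStep s) {f : ℝ → ℝ} (hf : Follows n s f) (hn : 0 < n)
    (ρ : ℝ) : theta n ρ f = ∑ i ∈ range n, ∑ j ∈ range n, W ρ s i j := by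
  have hfp := hf.eqOn (follows_path s n) hn
  have h0n : (0 : ℝ) ≤ n := n.cast_nonneg
  -- Outside `[0, n]` the function `f` is arbitrary, so it is replaced by the continuous `path s n`
  -- before measurability is used.
  have h1 : theta n ρ f
      = ∫ y in (0 : ℝ)..n, ∫ x in (0 : ℝ)..n, ((path s n x - path s n y) / (x - y) - ρ) ^ 2 := by
    unfold theta
    refine intervalIntegral.integral_congr fun y hy => intervalIntegral.integral_congr fun x hx => ?_
    rw [Set.uIcc_of_le h0n] at hx hy
    rw [hfp hx, hfp hy]
  have hc := continuous_path s n
  rw [h1, integral_square_eq_sum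
    (Q := fun y x => ((path s n x - path s n y) / (x - y) - ρ) ^ 2) (M := (1 + |ρ|) ^ 2)]
  · refine sum_congr rfl fun i hi => sum_congr rfl fun j hj => ?_
    refine intervalIntegral.integral_congr fun b hb => intervalIntegral.integral_congr fun a ha => ?_
    rw [Set.uIcc_of_le zero_le_one] at ha hb
    simp only [kern]
    rw [follows_path s n i (mem_range.1 hi) a ha, follows_path s n j (mem_range.1 hj) b hb]
    congr 3 <;> ring
  · have := hc.measurable
    fun_prop
  · intro y x
    rw [abs_pow]
    gcongr
    refine (abs_sub _ _).trans ?_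
    gcongr
    rw [abs_div]
    exact div_le_one_of_le₀ (abs_path_sub_le hs n x y) (abs_nonneg _)

end LocalOpt

namespace LocalOpt

open Finset

/-! ### Cells and hooks in terms of steps -/

/-- The number of up-steps among the first `i` steps. -/
def ups (s : ℕ → ℤ) (i : ℕ) : ℕ := Nat.count (fun t => s t = 1) i

/-- The number of down-steps among the first `i` steps. -/
def downs (s : ℕ → ℤ) (i : ℕ) : ℕ := Nat.count (fun t => s t = -1) i

variable {s : ℕ → ℤ}

theorem ups_mono (s : ℕ → ℤ) : Monotone (ups s) := Nat.count_monotone _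

theorem downs_mono (s : ℕ → ℤ) : Monotone (downs s) := Nat.count_monotone _

theorem ups_succ_of_up {i : ℕ} (h : s i = 1) : ups s (i + 1) = ups s i + 1 := by
  simp [ups, Nat.count_succ, h]

theorem downs_succ_of_down {i : ℕ} (h : s i = -1) : downs s (i + 1) = downs s i + 1 := by
  simp [downs, Nat.count_succ, h]

theorem ups_succ_of_down {i : ℕ} (h : s i = -1) : ups s (i + 1) = ups s i := by
  simp [ups, Nat.count_succ, h]

theorem downs_succ_of_up {i : ℕ} (h : s i = 1) : downs s (i + 1) = downs s i := by
  simp [downs, Nat.count_succ, h]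

theorem IsStep.ups_add_downs (hs : IsStep s) (i : ℕ) : ups s i + downs s i = i := by
  induction i with
  | zero => simp [ups, downs]
  | succ i ih =>
    rcases hs i with h | h
    · rw [ups_succ_of_up h, downs_succ_of_up h]; omega
    · rw [ups_succ_of_down h, downs_succ_of_down h]; omega

theorem IsStep.ht_eq (hs : IsStep s) (i : ℕ) : ht s i = ups s i - downs s i := by
  induction i with
  | zero => simp [ups, downs, ht]
  | succ i ih =>
    rw [ht_succ, ih]
    rcases hs i with h | h
    · rw [ups_succ_of_up h, downs_succ_of_up h, h]; push_cast; ring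
    · rw [ups_succ_of_down h, downs_succ_of_down h, h]; push_cast; ring

theorem exists_up {p d : ℕ} (h : p < ups s d) : ∃ i < d, s i = 1 ∧ ups s i = p := by
  induction d with
  | zero => simp [ups] at h
  | succ d ih =>
    by_cases hp : p < ups s d
    · obtain ⟨i, hi, h'⟩ := ih hp
      exact ⟨i, by omega, h'⟩
    · by_cases hd : s d = 1
      · rw [ups_succ_of_up hd] at h
        exact ⟨d, by omega, hd, by omega⟩
      · simp only [ups, Nat.count_succ, hd, if_false, add_zero] at h hp
        exact absurd h hp

theorem exists_down {p d : ℕ} (h : p < downs s d) : ∃ i < d, s i = -1 ∧ downs s i = p := by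
  induction d with
  | zero => simp [downs] at h
  | succ d ih =>
    by_cases hp : p < downs s d
    · obtain ⟨i, hi, h'⟩ := ih hp
      exact ⟨i, by omega, h'⟩
    · by_cases hd : s d = -1
      · rw [downs_succ_of_down hd] at h
        exact ⟨d, by omega, hd, by omega⟩
      · simp only [downs, Nat.count_succ, hd, if_false, add_zero] at h hp
        exact absurd h hp

theorem ups_lt_of_lt {i t : ℕ} (hi : s i = 1) (h : i < t) : ups s i < ups s t := by
  have := ups_mono s (Nat.succ_le_of_lt h)
  rw [Nat.succ_eq_add_one, ups_succ_of_up hi] at this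
  omega

theorem downs_lt_of_lt {i t : ℕ} (hi : s i = -1) (h : i < t) : downs s i < downs s t := by
  have := downs_mono s (Nat.succ_le_of_lt h)
  rw [Nat.succ_eq_add_one, downs_succ_of_down hi] at this
  omega

theorem up_inj {i t : ℕ} (hi : s i = 1) (ht : s t = 1) (h : ups s i = ups s t) : i = t := by
  rcases lt_trichotomy i t with h' | h' | h'
  · have := ups_lt_of_lt hi h'; omega
  · exact h'
  · have := ups_lt_of_lt ht h'; omega

theorem down_inj {i t : ℕ} (hi : s i = -1) (ht : s t = -1) (h : downs s i = downs s t) : i = t := by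
  rcases lt_trichotomy i t with h' | h' | h'
  · have := downs_lt_of_lt hi h'; omega
  · exact h'
  · have := downs_lt_of_lt ht h'; omega

variable {n : ℕ} {f : ℝ → ℝ}

theorem Follows.apply_nat (hf : Follows n s f) (hn : 0 < n) {i : ℕ} (hi : i ≤ n) :
    f i = ht s i := by
  rcases hi.eq_or_lt with rfl | hi
  · have := hf (i - 1) (by omega) 1 (by simp)
    rw [← Nat.cast_succ, Nat.succ_eq_add_one, Nat.sub_add_cancel hn] at this
    rw [this]
    conv_rhs => rw [← Nat.sub_add_cancel hn, ht_succ]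
    push_cast
    ring
  · simpa using hf i hi 0 (by simp)

theorem Follows.abs_sub_le (hf : Follows n s f) (hs : IsStep s) (hn : 0 < n) {x y : ℝ}
    (hx : x ∈ Set.Icc 0 (n : ℝ)) (hy : y ∈ Set.Icc 0 (n : ℝ)) : |f x - f y| ≤ |x - y| := by
  have h := hf.eqOn (follows_path s n) hn
  rw [h hx, h hy]
  exact abs_path_sub_le hs n x y

/-- The cell in the column of the up-step `i` and in the row of the down-step `j`. -/
def cellOf (s : ℕ → ℤ) (i j : ℕ) : ℤ × ℤ := (ups s i, -(downs s j : ℤ) - 1)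

/-- After `i` steps the path is at the lattice point with diagonal coordinates `(ups s i, -downs s
i)`. The lower boundary consists of the lines `p = 0` and `q = -downs s n`. A cell above it is thus
a column, that is an up-step, with a row, that is a down-step; it lies below the path exactly when
the up-step comes first. In both directions the test point is the top vertex, at abscissa `d = p -
q`. -/
theorem mem_cells_iff (hf : Follows n s f) (hs : IsStep s) (hn : 0 < n) (c : ℤ × ℤ) :
    c ∈ cells n f ↔ ∃ i j, i < j ∧ j < n ∧ s i = 1 ∧ s j = -1 ∧ cellOf s i j = c := by
  obtain ⟨p, q⟩ := c
  have hfn := hf.apply_nat hn le_rfl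
  have hUDn := hs.ups_add_downs n
  have hUDn' : (ups s n : ℝ) + downs s n = n := by exact_mod_cast hUDn
  have hhn : (ht s n : ℝ) = ups s n - downs s n := by rw [hs.ht_eq]; push_cast; ring
  constructor
  · intro hc
    have hl := @hc ((p : ℝ) - q - 1, (p : ℝ) + q + 1)
      (by refine ⟨?_, ?_, ?_, ?_⟩ <;> dsimp only <;> linarith)
    have hr := @hc ((p : ℝ) - q + 1, (p : ℝ) + q + 1)
      (by refine ⟨?_, ?_, ?_, ?_⟩ <;> dsimp only <;> linarith)
    have htop := @hc ((p : ℝ) - q, (p : ℝ) + q + 2)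
      (by refine ⟨?_, ?_, ?_, ?_⟩ <;> dsimp only <;> linarith)
    obtain ⟨⟨h1, -⟩, h2, -⟩ := hl
    obtain ⟨⟨-, h3⟩, h4, -⟩ := hr
    obtain ⟨-, -, h5⟩ := htop
    have h2 := (max_le_iff.1 h2).1
    have h4 := (max_le_iff.1 h4).2
    simp only at h1 h2 h3 h4 h5
    rw [hfn, hhn] at h4
    have h1' : 1 ≤ p - q := by
      have : (1 : ℝ) ≤ p - q := by linarith
      exact_mod_cast this
    have h2' : 0 ≤ p := by
      have : (0 : ℝ) ≤ p := by linarith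
      exact_mod_cast this
    have h3' : p - q + 1 ≤ n := by exact_mod_cast h3
    have h4' : -(downs s n : ℤ) ≤ q := by
      have : -(downs s n : ℝ) ≤ q := by linarith
      exact_mod_cast this
    obtain ⟨d, hd⟩ := Int.eq_ofNat_of_zero_le (by omega : 0 ≤ p - q)
    have hd' : ((d : ℕ) : ℝ) = (p : ℝ) - q := by
      have : ((d : ℤ) : ℝ) = ((p - q : ℤ) : ℝ) := by rw [hd]
      simpa using this
    rw [← hd', hf.apply_nat hn (by omega), hs.ht_eq] at h5
    have h5' : p + q + 2 ≤ (ups s d : ℤ) - downs s d := by exact_mod_cast h5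
    have hUD := hs.ups_add_downs d
    obtain ⟨i, hi, hsi, hpi⟩ := exists_up (s := s) (p := p.toNat) (d := d) (by omega)
    obtain ⟨j, hj, hsj, hqj⟩ := exists_down (s := s) (p := (-q - 1).toNat) (d := n) (by omega)
    refine ⟨i, j, ?_, hj, hsi, hsj, ?_⟩
    · by_contra hij
      have := downs_lt_of_lt hsj (show j < d by omega)
      omega
    · unfold cellOf
      rw [hpi, hqj]
      ext <;> simp only <;> omega
  · rintro ⟨i, j, hij, hj, hsi, hsj, hc⟩
    unfold cellOf at hc
    obtain ⟨rfl, rfl⟩ := Prod.mk.inj hc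
    have hUDj := hs.ups_add_downs j
    have hUi := ups_lt_of_lt hsi hij
    have hDj := downs_lt_of_lt hsj hj
    -- The abscissa of the top vertex. Once this vertex is known to be below the graph, the
    -- Lipschitz bound places the whole cell below it.
    set d := ups s i + downs s j + 1 with hd
    have hdj : d ≤ j := by omega
    have hUd : ups s i + 1 ≤ ups s d := by
      by_contra hlt
      have h1 := hs.ups_add_downs d
      have h2 := downs_mono s hdj
      omega
    have hUDd := hs.ups_add_downs d
    have hdR : (d : ℝ) = ups s i + downs s j + 1 := by rw [hd]; push_cast; ring
    have hUdR : (ups s i : ℝ) + 1 ≤ ups s d := by exact_mod_cast hUd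
    have hUDdR : (ups s d : ℝ) + downs s d = d := by exact_mod_cast hUDd
    have hDjR : (downs s j : ℝ) + 1 ≤ downs s n := by exact_mod_cast hDj
    have hdnR : (d : ℝ) + 1 ≤ n := by exact_mod_cast (by omega : d + 1 ≤ n)
    have hU0 : (0 : ℝ) ≤ ups s i := Nat.cast_nonneg _
    have hD0 : (0 : ℝ) ≤ downs s j := Nat.cast_nonneg _
    have hfd : f d = (ups s d : ℝ) - downs s d := by
      rw [hf.apply_nat hn (by omega), hs.ht_eq]; push_cast; ring
    rintro ⟨x, y⟩ ⟨h1, h2, h3, h4⟩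
    push_cast at h1 h2 h3 h4
    have hx : x ∈ Set.Icc 0 (n : ℝ) := ⟨by linarith, by linarith⟩
    have hlip := abs_le.1 (hf.abs_sub_le hs hn (x := x) (y := d) hx ⟨by positivity, by linarith⟩)
    refine ⟨hx, max_le ?_ ?_, ?_⟩
    · dsimp only; linarith
    · dsimp only; rw [hfn, hhn]; linarith
    · dsimp only
      rcases abs_cases (x - d) with ⟨h5, -⟩ | ⟨h5, -⟩ <;> rw [h5] at hlip <;> linarith [hlip.1]

/-- The hook is in bijection with the steps `t` in `(i, j]`: a down-step `t` gives the cell of `i`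
and `t`, in the same column, and an up-step `t` gives the cell of `t` and `j`, in the same row. The
corner itself is `t = j`. -/
theorem hookLength_cellOf (hf : Follows n s f) (hs : IsStep s) (hn : 0 < n) {i j : ℕ} (hij : i < j)
    (hj : j < n) (hsi : s i = 1) (hsj : s j = -1) : hookLength n f (cellOf s i j) = j - i := by
  have hset : {d ∈ cells n f | (d.2 = (cellOf s i j).2 ∧ (cellOf s i j).1 ≤ d.1) ∨
      (d.1 = (cellOf s i j).1 ∧ (cellOf s i j).2 ≤ d.2)}
      = (fun t => if s t = -1 then cellOf s i t else cellOf s t j) '' Set.Ioc i j := by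
    ext d
    simp only [mem_cells_iff hf hs hn, Set.mem_image, Set.mem_Ioc]
    constructor
    · rintro ⟨⟨i', j', hij', hj', hsi', hsj', rfl⟩, h⟩
      simp only [cellOf] at h
      rcases h with ⟨h1, h2⟩ | ⟨h1, h2⟩
      · have : j' = j := down_inj hsj' hsj (by omega)
        subst this
        rcases eq_or_ne i' i with rfl | hne
        · exact ⟨j', ⟨hij', le_rfl⟩, by simp [hsj']⟩
        · have hii : i < i' := by
            by_contra hlt
            have := ups_lt_of_lt hsi' (show i' < i by omega)
            omega
          exact ⟨i', ⟨hii, hij'.le⟩, by simp [hsi']⟩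
      · have : i' = i := up_inj hsi' hsi (by omega)
        subst this
        have hjj : j' ≤ j := by
          by_contra hlt
          have := downs_lt_of_lt hsj (show j < j' by omega)
          omega
        exact ⟨j', ⟨hij', hjj⟩, by simp [hsj']⟩
    · rintro ⟨t, ⟨h1, h2⟩, rfl⟩
      rcases hs t with h | h
      · have htj : t < j := lt_of_le_of_ne h2 fun e => by rw [e, hsj] at h; omega
        have hne : ¬ s t = -1 := by omega
        simp only [hne, if_false]
        refine ⟨⟨t, j, htj, hj, h, hsj, rfl⟩, Or.inl ⟨rfl, ?_⟩⟩
        have := ups_mono s h1.le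
        simp only [cellOf]
        omega
      · simp only [h, if_true]
        refine ⟨⟨i, t, h1, by omega, hsi, h, rfl⟩, Or.inr ⟨rfl, ?_⟩⟩
        have := downs_mono s h2
        simp only [cellOf]
        omega
  unfold hookLength
  rw [hset, Set.InjOn.ncard_image]
  · rw [← Finset.coe_Ioc, Set.ncard_coe_finset, Nat.card_Ioc]
  · intro t ht t' ht' heq
    have hu : ∀ r ∈ Set.Ioc i j, ups s i < ups s r := fun r hr => ups_lt_of_lt hsi hr.1
    have h1 := hu t ht
    have h2 := hu t' ht'
    rcases hs t with h | h <;> rcases hs t' with h' | h' <;>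
      simp only [h, h', cellOf, if_true, if_false, Prod.mk.injEq, Int.reduceNeg,
        show ¬ ((1 : ℤ) = -1) by decide] at heq
    · exact up_inj h h' (by omega)
    · omega
    · omega
    · exact down_inj h h' (by omega)

theorem thetaTilde_eq (hf : Follows n s f) (hs : IsStep s) (hn : 0 < n) :
    thetaTilde n f = ∑ i ∈ range n, ∑ j ∈ range n, hk s i j := by
  have himg : (cells_finite n f).toFinset
      = (((range n) ×ˢ (range n)).filter fun z => z.1 < z.2 ∧ s z.1 = 1 ∧ s z.2 = -1).image
        fun z => cellOf s z.1 z.2 := by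
    ext c
    simp only [Set.Finite.mem_toFinset, mem_cells_iff hf hs hn, mem_image, mem_filter, mem_product,
      mem_range, Prod.exists]
    constructor
    · rintro ⟨i, j, h1, h2, h3, h4, h5⟩
      exact ⟨i, j, ⟨⟨by omega, h2⟩, h1, h3, h4⟩, h5⟩
    · rintro ⟨i, j, ⟨⟨_, h2⟩, h1, h3, h4⟩, h5⟩
      exact ⟨i, j, h1, h2, h3, h4, h5⟩
  unfold thetaTilde
  rw [himg, sum_image, sum_filter, sum_product]
  · refine sum_congr rfl fun i hi => sum_congr rfl fun j hj => ?_
    unfold hk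
    simp only
    split_ifs with h
    · rw [hookLength_cellOf hf hs hn h.1 (mem_range.1 hj) h.2.1 h.2.2]
    · rfl
  · rintro ⟨i, j⟩ h ⟨i', j'⟩ h' heq
    simp only [coe_filter, Set.mem_ofPred_eq] at h h'
    simp only [cellOf, Prod.mk.injEq] at heq
    rw [up_inj h.2.2.1 h'.2.2.1 (by omega), down_inj h.2.2.2 h'.2.2.2 (by omega)]

/-! ### Reduction of the minimum to step sequences. -/

theorem Theta_eq (hf : Follows n s f) (hs : IsStep s) (hn : 0 < n) (ρ : ℝ) :
    Theta n ρ f = E ρ s n := by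
  unfold Theta E pair
  rw [theta_eq hs hf hn, thetaTilde_eq hf hs hn, mul_sum]
  simp only [sum_add_distrib, mul_sum]

theorem image_Theta (hn : 0 < n) (ρ : ℝ) :
    Theta n ρ '' Sloc n = (fun s => E ρ s n) '' {s | IsStep s} := by
  ext v
  constructor
  · rintro ⟨f, hf, rfl⟩
    obtain ⟨s, hs, h⟩ := exists_follows hf
    exact ⟨s, hs, (Theta_eq h hs hn ρ).symm⟩
  · rintro ⟨s, hs, rfl⟩
    exact ⟨path s n, path_mem_Sloc hs n, Theta_eq (follows_path s n) hs hn ρ⟩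

/-- Only the first `n` signs matter. This is what makes the minimum attained. -/
theorem finite_energies (n : ℕ) (ρ : ℝ) : ((fun s => E ρ s n) '' {s | IsStep s}).Finite := by
  refine (Set.finite_range fun v : Fin n → Bool =>
    E ρ (fun i => if h : i < n then (if v ⟨i, h⟩ then 1 else -1) else 1) n).subset ?_
  rintro _ ⟨s, hs, rfl⟩
  refine ⟨fun i => decide (s i = 1), E_congr fun t ht => ?_⟩
  rcases hs t with h | h <;> simp [ht, h]

/-- The least energy of `n` steps. -/
noncomputable def minE (ρ : ℝ) (n : ℕ) : ℝ := sInf ((fun s => E ρ s n) '' {s | IsStep s})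

theorem isLeast_minE (n : ℕ) (ρ : ℝ) :
    IsLeast ((fun s => E ρ s n) '' {s | IsStep s}) (minE ρ n) := by
  have hne : ((fun s => E ρ s n) '' {s | IsStep s}).Nonempty := ⟨_, fun _ => 1, fun _ => Or.inl rfl, rfl⟩
  have hfin := finite_energies n ρ
  exact ⟨hne.csInf_mem hfin, fun v hv => csInf_le hfin.bddBelow hv⟩

theorem sigmaLoc_eq_minE (hn : 0 < n) (ρ : ℝ) : sigmaLoc n ρ = minE ρ n := by
  unfold sigmaLoc minE
  rw [image_Theta hn]

theorem isLeast_sigmaLoc (hn : 0 < n) (ρ : ℝ) :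
    IsLeast (Theta n ρ '' Sloc n) (sigmaLoc n ρ) := by
  rw [sigmaLoc_eq_minE hn, image_Theta hn]
  exact isLeast_minE n ρ

theorem exists_E_eq_minE (n : ℕ) (ρ : ℝ) : ∃ s, IsStep s ∧ E ρ s n = minE ρ n :=
  (isLeast_minE n ρ).1

theorem minE_le (n : ℕ) (ρ : ℝ) (hs : IsStep s) : minE ρ n ≤ E ρ s n :=
  (isLeast_minE n ρ).2 ⟨s, hs, rfl⟩

theorem minE_nonneg (n : ℕ) (ρ : ℝ) : 0 ≤ minE ρ n := by
  obtain ⟨s, _, h⟩ := exists_E_eq_minE n ρ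
  rw [← h]
  exact E_nonneg _ _ _

theorem minE_superadd (ρ : ℝ) (m n : ℕ) : minE ρ m + minE ρ n ≤ minE ρ (m + n) := by
  obtain ⟨s, hs, h⟩ := exists_E_eq_minE (m + n) ρ
  rw [← h]
  exact (add_le_add (minE_le m ρ hs) (minE_le n ρ (hs.shift m))).trans (E_superadd ρ s m n)

end LocalOpt

namespace LocalOpt

open Finset

/-! ### Elementary sums -/

/-- The harmonic sum. -/
noncomputable def harm (L : ℕ) : ℝ := ∑ r ∈ range L, 1 / ((r : ℝ) + 1)

theorem harm_mono {L M : ℕ} (h : L ≤ M) : harm L ≤ harm M :=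
  sum_le_sum_of_subset_of_nonneg (range_mono h) fun _ _ _ => by positivity

theorem one_le_harm {L : ℕ} (h : 1 ≤ L) : 1 ≤ harm L := by
  have := harm_mono h
  simpa [harm] using this

theorem harm_nonneg (L : ℕ) : 0 ≤ harm L := sum_nonneg fun _ _ => by positivity

theorem harm_reflect (L : ℕ) : ∑ k ∈ range L, 1 / ((L : ℝ) - k) = harm L := by
  rw [harm, ← sum_range_reflect]
  refine sum_congr rfl fun k hk => ?_
  have := mem_range.1 hk
  rw [Nat.sub_sub, Nat.cast_sub (by omega)]
  push_cast
  congr 1; ring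

theorem sum_inv_sq_le {x : ℝ} (hx : 1 ≤ x) (m : ℕ) : ∑ j ∈ range m, 1 / (x + j) ^ 2 ≤ 2 / x := by
  have : ∑ j ∈ range m, 1 / (x + j) ^ 2 ≤ 2 / x - 2 / (x + m) := by
    induction m with
    | zero => simp
    | succ m ih =>
      rw [sum_range_succ]
      have hm : (0 : ℝ) ≤ m := m.cast_nonneg
      have h1 : 1 / (x + m) ^ 2 ≤ 2 / (x + m) - 2 / (x + (m + 1)) := by
        rw [div_sub_div _ _ (by positivity) (by positivity), div_le_div_iff₀ (by positivity) (by positivity)]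
        nlinarith [mul_nonneg (by linarith : 0 ≤ x + m) (by linarith : 0 ≤ x + m - 1)]
      push_cast
      linarith
  have h2 : 0 ≤ 2 / (x + m) := by positivity
  linarith

theorem sum_inv_sq_shift_le (a m : ℕ) : ∑ b ∈ range m, 1 / ((a : ℝ) + b + 1) ^ 2
    ≤ 2 / ((a : ℝ) + 1) := by
  have := sum_inv_sq_le (x := (a : ℝ) + 1) (by linarith [(Nat.cast_nonneg a : (0 : ℝ) ≤ a)]) m
  refine le_trans (le_of_eq (sum_congr rfl fun b _ => ?_)) this
  congr 2; ring

theorem sum_inv_sqrt_le (L : ℕ) : ∑ r ∈ range L, 1 / √((r : ℝ) + 1) ≤ 2 * √L := by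
  induction L with
  | zero => simp
  | succ L ih =>
    rw [sum_range_succ]
    push_cast
    have hL : (0 : ℝ) ≤ L := L.cast_nonneg
    have h1 : 0 < √((L : ℝ) + 1) := Real.sqrt_pos.2 (by linarith)
    have h2 : √(L : ℝ) ≤ √((L : ℝ) + 1) := Real.sqrt_le_sqrt (by linarith)
    have h3 : 1 / √((L : ℝ) + 1) ≤ 2 * √((L : ℝ) + 1) - 2 * √(L : ℝ) := by
      rw [div_le_iff₀ h1]
      nlinarith [Real.sq_sqrt hL, Real.sq_sqrt (by linarith : (0 : ℝ) ≤ L + 1),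
        sq_nonneg (√((L : ℝ) + 1) - √(L : ℝ))]
    linarith

theorem sum_gap_le {g : ℝ → ℝ} (hg : ∀ r : ℕ, 0 ≤ g ((r : ℝ) + 1)) {i L : ℕ} (hi : i < L) :
    ∑ j ∈ range L, g (gap i j) ≤ 2 * ∑ r ∈ range L, g ((r : ℝ) + 1) := by
  obtain ⟨k, rfl⟩ := Nat.exists_eq_add_of_lt hi
  rw [show i + k + 1 = (i + 1) + k by ring, sum_range_add, two_mul]
  refine add_le_add ?_ ?_
  · calc _ = ∑ r ∈ range (i + 1), g ((r : ℝ) + 1) := by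
          rw [← sum_range_reflect]
          refine sum_congr rfl fun r hr => ?_
          have := mem_range.1 hr
          rw [gap_comm, gap_of_le (by omega), Nat.add_sub_cancel, Nat.cast_sub (by omega)]
          congr 1; ring
      _ ≤ _ := sum_le_sum_of_subset_of_nonneg (range_mono (by omega)) fun _ _ _ => hg _
  · calc _ = ∑ r ∈ range k, g (((1 + r : ℕ) : ℝ) + 1) := by
          refine sum_congr rfl fun r hr => ?_
          rw [gap_of_le (by omega)]
          push_cast; congr 1; ring
      _ ≤ _ := sum_shift_le (c := fun r => g ((r : ℝ) + 1)) hg (by omega)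

theorem sum_inv_gap_sq_le {i L : ℕ} (hi : i < L) : ∑ j ∈ range L, 1 / gap i j ^ 2 ≤ 4 := by
  refine (sum_gap_le (g := fun x => 1 / x ^ 2) (fun r => by positivity) hi).trans ?_
  have := sum_inv_sq_shift_le 0 L
  simp only [Nat.cast_zero, zero_add] at this
  linarith

theorem sum_inv_sqrt_gap_le (L : ℕ) :
    ∑ i ∈ range L, ∑ j ∈ range L, 1 / √(gap i j / L) ≤ 4 * (L : ℝ) ^ 2 := by
  have hrow : ∀ i ∈ range L, ∑ j ∈ range L, 1 / √(gap i j / L) ≤ 4 * L := by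
    intro i hi
    have h0 : (0 : ℝ) ≤ L := L.cast_nonneg
    calc _ = √L * ∑ j ∈ range L, 1 / √(gap i j) := by
          rw [mul_sum]
          refine sum_congr rfl fun j _ => ?_
          rw [Real.sqrt_div (gap_pos i j).le, one_div_div]
          ring
      _ ≤ √L * (2 * (2 * √L)) := by
          gcongr
          refine (sum_gap_le (g := fun x => 1 / √x) (fun r => by positivity) (mem_range.1 hi)).trans ?_
          gcongr
          exact sum_inv_sqrt_le L
      _ = 4 * L := by nlinarith [Real.mul_self_sqrt h0]
  refine (sum_le_sum hrow).trans (le_of_eq ?_)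
  simp; ring

/-- Summing the inverse square over `j ≥ t` leaves `2 / gap t i`, and then the sum over `i` is
harmonic. So one changed step costs only a logarithm. -/
theorem sum_straddle_le {t L : ℕ} (ht : t < L) :
    ∑ i ∈ range L, ∑ j ∈ range L, (if i ≤ t ∧ t ≤ j then 1 / gap i j ^ 2 else 0) ≤ 4 * harm L := by
  have hrow : ∀ i ∈ range L, ∑ j ∈ range L, (if i ≤ t ∧ t ≤ j then 1 / gap i j ^ 2 else 0)
      ≤ 2 * (1 / gap t i) := by
    intro i _
    by_cases hit : i ≤ t
    · obtain ⟨a, rfl⟩ := Nat.exists_eq_add_of_le hit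
      obtain ⟨m, rfl⟩ := Nat.exists_eq_add_of_le ht.le
      rw [sum_range_add, sum_eq_zero, zero_add]
      · refine le_trans (le_of_eq (sum_congr rfl fun b _ => ?_)) ((sum_inv_sq_shift_le a m).trans (le_of_eq ?_))
        · rw [if_pos ⟨by omega, by omega⟩, gap_of_le (by omega)]
          push_cast; congr 2; ring
        · rw [gap_comm, gap_of_le (by omega), mul_one_div]
          push_cast; congr 1; ring
      · intro j hj
        have := mem_range.1 hj
        rw [if_neg (by omega)]
    · rw [sum_eq_zero]
      · have := gap_pos t i
        positivity
      · intro j _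
        rw [if_neg (by omega)]
  refine (sum_le_sum hrow).trans ?_
  rw [← mul_sum]
  have := sum_gap_le (g := fun x => 1 / x) (fun r => by positivity) ht
  unfold harm
  linarith

theorem sum_rotate (L : ℕ) (F : ℕ → ℕ → ℕ → ℝ) :
    ∑ i ∈ range L, ∑ j ∈ range L, ∑ t ∈ range L, F i j t
      = ∑ t ∈ range L, ∑ i ∈ range L, ∑ j ∈ range L, F i j t := by
  rw [sum_comm]
  exact (sum_congr rfl fun i _ => sum_comm).trans (sum_comm.trans
    (sum_congr rfl fun t _ => sum_comm))

/-- The pairs of indices that have a marked index between them, weighted by the inverse square of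
their distance. -/
theorem sum_between_le {χ : ℕ → ℝ} (hχ : ∀ t, 0 ≤ χ t) (L : ℕ) :
    ∑ i ∈ range L, ∑ j ∈ range L,
      (∑ t ∈ range L, if min i j ≤ t ∧ t ≤ max i j then χ t else 0) / gap i j ^ 2
      ≤ 8 * harm L * ∑ t ∈ range L, χ t := by
  have h1 : ∀ i j t, (if min i j ≤ t ∧ t ≤ max i j then χ t else 0) / gap i j ^ 2
      ≤ χ t * (if i ≤ t ∧ t ≤ j then 1 / gap i j ^ 2 else 0)
        + χ t * (if j ≤ t ∧ t ≤ i then 1 / gap j i ^ 2 else 0) := by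
    intro i j t
    have hg := gap_pos i j
    have hg' := gap_pos j i
    have h2 := hχ t
    by_cases h : min i j ≤ t ∧ t ≤ max i j
    · rw [if_pos h]
      rcases le_total i j with hij | hij
      · rw [min_eq_left hij, max_eq_right hij] at h
        rw [if_pos h, mul_one_div]
        exact le_add_of_nonneg_right (by split_ifs <;> positivity)
      · rw [min_eq_right hij, max_eq_left hij] at h
        rw [if_pos h, mul_one_div, gap_comm i j]
        exact le_add_of_nonneg_left (by split_ifs <;> positivity)
    · rw [if_neg h, zero_div]
      split_ifs <;> positivity
  calc _ ≤ ∑ i ∈ range L, ∑ j ∈ range L, ∑ t ∈ range L,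
        (χ t * (if i ≤ t ∧ t ≤ j then 1 / gap i j ^ 2 else 0)
        + χ t * (if j ≤ t ∧ t ≤ i then 1 / gap j i ^ 2 else 0)) := by
          refine sum_le_sum fun i _ => sum_le_sum fun j _ => ?_
          rw [sum_div]
          exact sum_le_sum fun t _ => h1 i j t
    _ = ∑ t ∈ range L, (χ t * (∑ i ∈ range L, ∑ j ∈ range L,
          (if i ≤ t ∧ t ≤ j then 1 / gap i j ^ 2 else 0))
        + χ t * (∑ j ∈ range L, ∑ i ∈ range L,
          (if j ≤ t ∧ t ≤ i then 1 / gap j i ^ 2 else 0))) := by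
          simp only [sum_add_distrib, mul_sum]
          congr 1
          · exact sum_rotate L fun i j t => χ t * (if i ≤ t ∧ t ≤ j then 1 / gap i j ^ 2 else 0)
          · rw [sum_comm]
            exact sum_rotate L fun j i t => χ t * (if j ≤ t ∧ t ≤ i then 1 / gap j i ^ 2 else 0)
    _ ≤ ∑ t ∈ range L, (χ t * (4 * harm L) + χ t * (4 * harm L)) := by
          refine sum_le_sum fun t ht => ?_
          have h2 := hχ t
          have h3 := sum_straddle_le (mem_range.1 ht)
          gcongr
    _ = _ := by rw [mul_sum]; exact sum_congr rfl fun t _ => by ring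

/-! ### Thinning a path -/

theorem ht_neg (s : ℕ → ℤ) (i : ℕ) : ht (fun t => -s t) i = -ht s i := by simp [ht]

theorem IsStep.neg {s : ℕ → ℤ} (hs : IsStep s) : IsStep fun t => -s t := fun i => by
  rcases hs i with h | h <;> simp [h]

/-- The surplus up-steps are flipped as evenly as possible: of the first `k` up-steps the integer
part of `k V / U` is kept. Before rounding, this scales the number of up-steps by `κ = V / U`, hence
changes heights affinely with `c = κ - 1`. The rounding error `e` lies in `[-2, 0]` and vanishes at
`L`, and exactly `U - V` steps are flipped. -/
theorem exists_thinning_of_le {s : ℕ → ℤ} (hs : IsStep s) {L V : ℕ} (hV : V ≤ ups s L) :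
    ∃ (s' : ℕ → ℤ) (κ c : ℝ) (e : ℕ → ℝ), IsStep s' ∧ 0 ≤ κ ∧ κ ≤ 1 ∧ |c| ≤ 1 - κ ∧
      (∀ k ≤ L, |e k| ≤ 2 ∧ (ht s' k : ℝ) = κ * ht s k + c * k + e k) ∧ e L = 0 ∧
      ht s' L = 2 * V - L ∧
      ∑ t ∈ range L, (if s t = s' t then (0 : ℝ) else 1) ≤ |(ht s L : ℝ) - ht s' L| / 2 := by
  set U := ups s L with hU
  have hht : ∀ s : ℕ → ℤ, IsStep s → ∀ k, ht s k = 2 * ups s k - k := fun s hs k => by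
    have := hs.ups_add_downs k
    rw [hs.ht_eq]
    omega
  rcases Nat.eq_zero_or_pos U with h0 | hpos
  · refine ⟨s, 1, 0, fun _ => 0, hs, zero_le_one, le_rfl, by simp, by simp, rfl, ?_, by simp⟩
    rw [hht s hs]
    omega
  · set T : ℕ → ℕ := fun k => ups s k * V / U with hT
    set s' : ℕ → ℤ := fun t => if s t = 1 ∧ T (t + 1) = T t then -1 else s t with hs'
    -- An up-step survives in `s'` exactly when it raises `T`, so that `T` counts the up-steps of
    -- `s'`.
    have hstep : IsStep s' := fun t => by
      simp only [hs']
      split_ifs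
      · exact Or.inr rfl
      · exact hs t
    have hups : ∀ k, ups s' k = T k := by
      intro k
      induction k with
      | zero => simp [ups, hT]
      | succ k ih =>
        rcases hs k with h | h
        · have h1 : T k ≤ T (k + 1) := Nat.div_le_div_right (Nat.mul_le_mul_right _ (ups_mono s k.le_succ))
          have h2 : T (k + 1) ≤ T k + 1 := by
            simp only [hT]
            rw [ups_succ_of_up h, add_mul, one_mul, ← Nat.add_div_right _ hpos]
            exact Nat.div_le_div_right (by omega)
          by_cases hk : T (k + 1) = T k
          · rw [ups_succ_of_down (by simp [hs', h, hk]), ih, hk]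
          · rw [ups_succ_of_up (by simp [hs', h, hk]), ih]
            omega
        · have h1 : s' k = -1 := by simp [hs', h]
          rw [ups_succ_of_down h1, ih]
          simp only [hT]
          rw [ups_succ_of_down h]
    have hUR : (0 : ℝ) < U := by exact_mod_cast hpos
    have hVU : (V : ℝ) ≤ U := by exact_mod_cast hV
    have hTL : T L = V := by simp [hT, ← hU, Nat.mul_div_cancel_left V hpos]
    have hhtL : ht s' L = 2 * V - L := by rw [hht s' hstep, hups, hTL]
    refine ⟨s', V / U, V / U - 1, fun k => 2 * (T k - ups s k * (V / U)), hstep, by positivity,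
      div_le_one_of_le₀ hVU hUR.le, ?_, ?_, ?_, hhtL, ?_⟩
    · rw [abs_sub_comm, abs_of_nonneg]
      exact sub_nonneg.2 (div_le_one_of_le₀ hVU hUR.le)
    · intro k _
      constructor
      · have h1 : (T k : ℝ) ≤ ups s k * (V / U) := by
          rw [← mul_div_assoc]
          exact_mod_cast (Nat.cast_div_le (α := ℝ) (m := ups s k * V) (n := U))
        have h2 : (ups s k : ℝ) * (V / U) ≤ T k + 1 := by
          rw [← mul_div_assoc, div_le_iff₀ hUR]
          have := Nat.lt_div_mul_add (a := ups s k * V) hpos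
          have : ups s k * V ≤ (T k + 1) * U := by
            simp only [hT]
            nlinarith
          exact_mod_cast this
        rw [abs_le]
        constructor <;> linarith
      · rw [hht s' hstep, hht s hs, hups]
        push_cast
        ring
    · simp only
      rw [hTL, ← hU]
      field_simp
      ring
    · have : ∑ t ∈ range L, (if s t = s' t then (0 : ℝ) else 1)
          = ∑ t ∈ range L, ((s t : ℝ) - s' t) / 2 := by
        refine sum_congr rfl fun t _ => ?_
        simp only [hs']
        rcases hs t with h | h
        · rw [h]
          by_cases h' : T (t + 1) = T t <;> simp [h']
        · simp [h]
      rw [this, ← sum_div, sum_sub_distrib]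
      gcongr
      unfold ht
      push_cast
      exact le_abs_self _

/-- A path can be corrected to have any given number of up-steps, by a nearly affine change. -/
theorem exists_thinning {s : ℕ → ℤ} (hs : IsStep s) {L V : ℕ} (hV : V ≤ L) :
    ∃ (s' : ℕ → ℤ) (κ c : ℝ) (e : ℕ → ℝ), IsStep s' ∧ 0 ≤ κ ∧ κ ≤ 1 ∧ |c| ≤ 1 - κ ∧
      (∀ k ≤ L, |e k| ≤ 2 ∧ (ht s' k : ℝ) = κ * ht s k + c * k + e k) ∧ e L = 0 ∧
      ht s' L = 2 * V - L ∧
      ∑ t ∈ range L, (if s t = s' t then (0 : ℝ) else 1) ≤ |(ht s L : ℝ) - ht s' L| / 2 := by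
  rcases le_total V (ups s L) with h | h
  · exact exists_thinning_of_le hs h
  · have hd : ups (fun t => -s t) L = downs s L := by
      simp only [ups, downs]
      congr 1
      ext t
      constructor <;> intro h <;> omega
    have hUD := hs.ups_add_downs L
    obtain ⟨s', κ, c, e, h1, h2, h3, h4, h5, h6, h7, h8⟩ :=
      exists_thinning_of_le hs.neg (L := L) (V := L - V) (by rw [hd]; omega)
    refine ⟨fun t => -s' t, κ, -c, fun k => -e k, h1.neg, h2, h3, by rwa [abs_neg], ?_, by simp [h6],
      ?_, ?_⟩
    · intro k hk
      obtain ⟨h9, h10⟩ := h5 k hk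
      rw [ht_neg] at h10 ⊢
      push_cast at h10 ⊢
      rw [abs_neg]
      exact ⟨h9, by linarith⟩
    · rw [ht_neg, h7]
      omega
    · rw [ht_neg] at h8 ⊢
      push_cast at h8 ⊢
      rw [← abs_neg, show -((ht s L : ℝ) - -ht s' L) = -ht s L - ht s' L by ring]
      refine le_trans (le_of_eq (sum_congr rfl fun t _ => ?_)) h8
      congr 1
      simp only [eq_iff_iff]
      constructor <;> intro h <;> omega

end LocalOpt

namespace LocalOpt

open Finset

variable {ρ : ℝ} {s s' : ℕ → ℤ}

/-! ### The energy of a corrected path -/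

/-- The indicator of the steps at which two paths differ. -/
def differ (s s' : ℕ → ℤ) (t : ℕ) : ℝ := if s t = s' t then 0 else 1

theorem differ_nonneg (s s' : ℕ → ℤ) (t : ℕ) : 0 ≤ differ s s' t := by
  unfold differ; split_ifs <;> norm_num

/-- The interactions inside `[0, L]`, with weights that favour the large distances. -/
noncomputable def tilt (ρ : ℝ) (s : ℕ → ℤ) (L : ℕ) : ℝ :=
  ∑ i ∈ range L, ∑ j ∈ range L, √(gap i j / L) * W ρ s i j

theorem ht_sub_congr {i j : ℕ} (hij : i ≤ j) (h : ∀ t, i ≤ t → t < j → s t = s' t) :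
    ht s j - ht s i = ht s' j - ht s' i := by
  induction j, hij using Nat.le_induction with
  | base => simp
  | succ j hij ih =>
    have h1 := ih fun t h1 h2 => h t h1 (by omega)
    rw [ht_succ, ht_succ, h j hij (by omega)]
    linarith

theorem hk_le_add_differ (i j : ℕ) :
    hk s' i j ≤ hk s i j + 4 * ((differ s s' i + differ s s' j) / gap i j ^ 2) := by
  have hg := gap_pos i j
  have h1 := differ_nonneg s s' i
  have h2 := differ_nonneg s s' j
  by_cases hi : s i = s' i
  · by_cases hj : s j = s' j
    · unfold hk
      rw [hi, hj]
      exact le_add_of_nonneg_right (by positivity)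
    · have : differ s s' j = 1 := if_neg hj
      rw [this] at *
      refine (hk_le s' i j).trans ?_
      have : 4 / gap i j ^ 2 ≤ 4 * ((differ s s' i + 1) / gap i j ^ 2) := by
        rw [← mul_div_assoc]; gcongr; linarith
      linarith [hk_nonneg s i j]
  · have : differ s s' i = 1 := if_neg hi
    rw [this] at *
    refine (hk_le s' i j).trans ?_
    have : 4 / gap i j ^ 2 ≤ 4 * ((1 + differ s s' j) / gap i j ^ 2) := by
      rw [← mul_div_assoc]; gcongr; linarith
    linarith [hk_nonneg s i j]

theorem gap_le {i j L : ℕ} (hi : i < L) (hj : j < L) : gap i j ≤ L := by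
  have hi' : (i : ℝ) + 1 ≤ L := by exact_mod_cast hi
  have hj' : (j : ℝ) + 1 ≤ L := by exact_mod_cast hj
  have hi0 : (0 : ℝ) ≤ i := i.cast_nonneg
  have hj0 : (0 : ℝ) ≤ j := j.cast_nonneg
  have : |(i : ℝ) - j| ≤ L - 1 := abs_le.2 ⟨by linarith, by linarith⟩
  unfold gap
  linarith

/-- If no step from `i` to `j` is changed, the interaction is unchanged. Otherwise `W_perturb` is
applied with `l = √(gap i j / L)`, and the rounding error is charged to a changed step between them.
This `l` makes the loss `l * W` small at short distances, while `1 / l` still sums to order `L ^ 2`.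
-/
theorem W_le_correct (hρ : |ρ| ≤ 1) (hs : IsStep s) (hs' : IsStep s') {L : ℕ} {κ c : ℝ}
    {e : ℕ → ℝ} (hκ0 : 0 ≤ κ) (hκ1 : κ ≤ 1) (hc : |c| ≤ 1 - κ)
    (he : ∀ k ≤ L, |e k| ≤ 2 ∧ (ht s' k : ℝ) = κ * ht s k + c * k + e k)
    {m : ℝ} (hm : 0 < m) (hm1 : m ≤ 1) {i j : ℕ} (hi : i < L) (hj : j < L) :
    W ρ s' i j ≤ (1 + m) * W ρ s i j + √(gap i j / L) * W ρ s i j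
      + 3 * (c - (1 - κ) * ρ) ^ 2 * (1 / √(gap i j / L))
      + 432 / m * ((∑ t ∈ range L, if min i j ≤ t ∧ t ≤ max i j then differ s s' t else 0)
        / gap i j ^ 2) := by
  have hg := gap_pos i j
  have hLpos : (0 : ℝ) < L := by exact_mod_cast (by omega : 0 < L)
  have hl : 0 < √(gap i j / L) := Real.sqrt_pos.2 (by positivity)
  have hl1 : √(gap i j / L) ≤ 1 := by
    rw [Real.sqrt_le_one]
    exact div_le_one_of_le₀ (gap_le hi hj) hLpos.le
  have hW := W_nonneg ρ s i j
  have hbt : ∀ t ∈ range L, 0 ≤ if min i j ≤ t ∧ t ≤ max i j then differ s s' t else 0 := by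
    intro t _
    have := differ_nonneg s s' t
    split_ifs <;> first | exact this | exact le_rfl
  have hb := sum_nonneg hbt
  by_cases hall : ∀ t, min i j ≤ t → t ≤ max i j → s t = s' t
  · have : W ρ s' i j = W ρ s i j := by
      refine W_congr ?_ rfl (hall i (by simp) (by simp)).symm (hall j (by simp) (by simp)).symm
      rcases le_total i j with h | h
      · rw [min_eq_left h, max_eq_right h] at hall
        have := ht_sub_congr h fun t h1 h2 => hall t h1 h2.le
        linarith
      · rw [min_eq_right h, max_eq_left h] at hall
        have := ht_sub_congr h fun t h1 h2 => hall t h1 h2.le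
        linarith
    rw [this, add_assoc, add_assoc, add_mul, one_mul, add_assoc]
    refine le_add_of_nonneg_right ?_
    positivity
  · push Not at hall
    obtain ⟨t, h1, h2, h3⟩ := hall
    have htL : t ∈ range L := mem_range.2 (by omega)
    have hone := single_le_sum hbt htL
    rw [if_pos ⟨h1, h2⟩, differ, if_neg h3] at hone
    have := W_perturb (i := i) (j := j) hρ hs hs' hκ0 hκ1 hc (e := e) (fun k hk => he k (by omega))
      hl hl1 hm hm1
    refine this.trans ?_
    have h5 : 432 / m / gap i j ^ 2 ≤ 432 / m * ((∑ t ∈ range L,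
        if min i j ≤ t ∧ t ≤ max i j then differ s s' t else 0) / gap i j ^ 2) := by
      rw [div_eq_mul_one_div (432 / m)]
      gcongr
    rw [mul_one_div]
    linarith

theorem E_le_correct (hρ : |ρ| ≤ 1) (hs : IsStep s) (hs' : IsStep s') {L : ℕ} {κ c : ℝ}
    {e : ℕ → ℝ} (hκ0 : 0 ≤ κ) (hκ1 : κ ≤ 1) (hc : |c| ≤ 1 - κ)
    (he : ∀ k ≤ L, |e k| ≤ 2 ∧ (ht s' k : ℝ) = κ * ht s k + c * k + e k)
    {m : ℝ} (hm : 0 < m) (hm1 : m ≤ 1) :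
    E ρ s' L ≤ (1 + m) * E ρ s L + 1 / 8 * tilt ρ s L
      + 3 / 2 * ((c - (1 - κ) * ρ) ^ 2 * (L : ℝ) ^ 2)
      + (432 * harm L / m + 32) * ∑ t ∈ range L, differ s s' t := by
  set β := c - (1 - κ) * ρ with hβ
  have hpair : ∀ i ∈ range L, ∀ j ∈ range L, pair ρ s' i j ≤ (1 + m) * pair ρ s i j
      + 1 / 8 * (√(gap i j / L) * W ρ s i j) + 3 / 8 * β ^ 2 * (1 / √(gap i j / L))
      + 54 / m * ((∑ t ∈ range L, if min i j ≤ t ∧ t ≤ max i j then differ s s' t else 0)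
        / gap i j ^ 2)
      + (4 * (differ s s' i * (1 / gap i j ^ 2)) + 4 * (differ s s' j * (1 / gap j i ^ 2))) := by
    intro i hi j hj
    have h1 := W_le_correct hρ hs hs' hκ0 hκ1 hc he hm hm1 (mem_range.1 hi) (mem_range.1 hj)
    have h2 := hk_le_add_differ (s := s) (s' := s') i j
    have h3 := mul_nonneg hm.le (hk_nonneg s i j)
    rw [← hβ] at h1
    have h4 : 432 / m = 8 * (54 / m) := by ring
    rw [h4] at h1
    rw [gap_comm j i]
    unfold pair
    have h5 : (differ s s' i + differ s s' j) / gap i j ^ 2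
        = differ s s' i * (1 / gap i j ^ 2) + differ s s' j * (1 / gap i j ^ 2) := by ring
    rw [h5] at h2
    linarith
  have hχ := differ_nonneg s s'
  have hD : ∑ i ∈ range L, ∑ j ∈ range L, differ s s' i * (1 / gap i j ^ 2)
      ≤ 4 * ∑ t ∈ range L, differ s s' t := by
    rw [mul_sum]
    refine sum_le_sum fun i hi => ?_
    rw [← mul_sum, mul_comm]
    have := hχ i
    gcongr
    exact sum_inv_gap_sq_le (mem_range.1 hi)
  have hD' := hD
  rw [sum_comm] at hD'
  have hB := sum_between_le hχ L
  have hS := sum_inv_sqrt_gap_le L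
  calc E ρ s' L ≤ _ := sum_le_sum fun i hi => sum_le_sum fun j hj => hpair i hi j hj
    _ = (1 + m) * E ρ s L + 1 / 8 * tilt ρ s L
      + 3 / 8 * β ^ 2 * (∑ i ∈ range L, ∑ j ∈ range L, 1 / √(gap i j / L))
      + 54 / m * (∑ i ∈ range L, ∑ j ∈ range L,
        (∑ t ∈ range L, if min i j ≤ t ∧ t ≤ max i j then differ s s' t else 0) / gap i j ^ 2)
      + (4 * (∑ i ∈ range L, ∑ j ∈ range L, differ s s' i * (1 / gap i j ^ 2))
        + 4 * (∑ i ∈ range L, ∑ j ∈ range L, differ s s' j * (1 / gap j i ^ 2))) := by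
        simp only [sum_add_distrib, ← mul_sum, E, tilt]
    _ ≤ (1 + m) * E ρ s L + 1 / 8 * tilt ρ s L + 3 / 8 * β ^ 2 * (4 * (L : ℝ) ^ 2)
      + 54 / m * (8 * harm L * ∑ t ∈ range L, differ s s' t)
      + (4 * (4 * ∑ t ∈ range L, differ s s' t) + 4 * (4 * ∑ t ∈ range L, differ s s' t)) := by
        gcongr
    _ = _ := by ring

/-! ### The behaviour of a path near the ends of an interval -/

/-- The weighted deviations of the path from the lines through its end points. -/
noncomputable def edge (ρ : ℝ) (s : ℕ → ℤ) (L : ℕ) : ℝ :=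
  ∑ k ∈ range L, dev ρ s (k + 1) ^ 2 / ((k : ℝ) + 1)
    + ∑ k ∈ range L, (dev ρ s k - dev ρ s L) ^ 2 / ((L : ℝ) - k)

theorem dev_zero (ρ : ℝ) (s : ℕ → ℤ) : dev ρ s 0 = 0 := by simp [dev, ht_zero]

theorem cast_sub_pos {k L : ℕ} (hk : k ∈ range L) : (1 : ℝ) ≤ (L : ℝ) - k := by
  have : (k : ℝ) + 1 ≤ L := by exact_mod_cast mem_range.1 hk
  linarith

theorem edge_left_le (ρ : ℝ) (s : ℕ → ℤ) (L : ℕ) :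
    ∑ k ∈ range L, dev ρ s (k + 1) ^ 2 / ((k : ℝ) + 1) ≤ edge ρ s L :=
  le_add_of_nonneg_right <| sum_nonneg fun k hk =>
    div_nonneg (sq_nonneg _) (by linarith [cast_sub_pos hk])

theorem edge_right_le (ρ : ℝ) (s : ℕ → ℤ) (L : ℕ) :
    ∑ k ∈ range L, (dev ρ s k - dev ρ s L) ^ 2 / ((L : ℝ) - k) ≤ edge ρ s L :=
  le_add_of_nonneg_left <| sum_nonneg fun k _ => by positivity

theorem edge_nonneg (ρ : ℝ) (s : ℕ → ℤ) (L : ℕ) : 0 ≤ edge ρ s L :=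
  (sum_nonneg fun k _ => by positivity).trans (edge_left_le ρ s L)

theorem sum_dev_sq_div_le (ρ : ℝ) (s : ℕ → ℤ) (L : ℕ) :
    ∑ k ∈ range L, dev ρ s k ^ 2 / ((k : ℝ) + 1) ≤ edge ρ s L := by
  refine le_trans ?_ (edge_left_le ρ s L)
  calc _ ≤ ∑ k ∈ range (L + 1), dev ρ s k ^ 2 / ((k : ℝ) + 1) :=
        sum_le_sum_of_subset_of_nonneg (range_mono L.le_succ) fun _ _ _ => by positivity
    _ = ∑ k ∈ range L, dev ρ s (k + 1) ^ 2 / ((k : ℝ) + 1 + 1) := by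
        rw [sum_range_succ', dev_zero]
        push_cast
        simp
    _ ≤ _ := sum_le_sum fun k _ => by gcongr; linarith

theorem sum_dev_sq_le (ρ : ℝ) (s : ℕ → ℤ) (L : ℕ) :
    ∑ k ∈ range L, dev ρ s k ^ 2 ≤ L * edge ρ s L := by
  calc _ ≤ ∑ k ∈ range L, L * (dev ρ s k ^ 2 / ((k : ℝ) + 1)) := by
        refine sum_le_sum fun k hk => ?_
        have : (k : ℝ) + 1 ≤ L := by exact_mod_cast mem_range.1 hk
        rw [mul_div_assoc', le_div_iff₀ (by positivity), mul_comm]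
        gcongr
    _ ≤ _ := by
        rw [← mul_sum]
        gcongr
        exact sum_dev_sq_div_le ρ s L

/-- The single term of `edge` containing `dev ρ s L` would lose a factor `L`. Going through every
intermediate `k` and averaging removes it. -/
theorem dev_sq_le_edge (ρ : ℝ) (s : ℕ → ℤ) {L : ℕ} (hL : 1 ≤ L) : dev ρ s L ^ 2 ≤ 4 * edge ρ s L := by
  have hLpos : (0 : ℝ) < L := by exact_mod_cast hL
  have h1 : ∑ k ∈ range L, (dev ρ s k - dev ρ s L) ^ 2 ≤ L * edge ρ s L := by
    calc _ ≤ ∑ k ∈ range L, L * ((dev ρ s k - dev ρ s L) ^ 2 / ((L : ℝ) - k)) := by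
          refine sum_le_sum fun k hk => ?_
          have h2 := cast_sub_pos hk
          have : (0 : ℝ) ≤ k := k.cast_nonneg
          rw [mul_div_assoc', le_div_iff₀ (by linarith), mul_comm]
          gcongr
          linarith
      _ ≤ _ := by
          rw [← mul_sum]
          gcongr
          exact edge_right_le ρ s L
  have h2 := sum_dev_sq_le ρ s L
  have h3 : ∑ k ∈ range L, dev ρ s L ^ 2
      ≤ ∑ k ∈ range L, (2 * dev ρ s k ^ 2 + 2 * (dev ρ s k - dev ρ s L) ^ 2) := by
    refine sum_le_sum fun k _ => ?_
    have := sub_sq_le (dev ρ s k) (dev ρ s k - dev ρ s L)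
    rw [sub_sub_cancel] at this
    linarith
  rw [sum_add_distrib, ← mul_sum, ← mul_sum, sum_const, card_range, nsmul_eq_mul] at h3
  have h4 : (L : ℝ) * dev ρ s L ^ 2 ≤ L * (4 * edge ρ s L) := by linarith
  exact le_of_mul_le_mul_left h4 hLpos

theorem add_three_sq_le (x y z : ℝ) : (x + y + z) ^ 2 ≤ 3 * x ^ 2 + 3 * y ^ 2 + 3 * z ^ 2 := by
  nlinarith [sq_nonneg (x - y), sq_nonneg (y - z), sq_nonneg (x - z)]

theorem edge_le_correct {L : ℕ} {κ c : ℝ} {e : ℕ → ℝ} (hκ0 : 0 ≤ κ) (hκ1 : κ ≤ 1)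
    (he : ∀ k ≤ L, |e k| ≤ 2 ∧ (ht s' k : ℝ) = κ * ht s k + c * k + e k) (heL : e L = 0) :
    edge ρ s' L ≤ 3 * edge ρ s L + 6 * ((c - (1 - κ) * ρ) ^ 2 * (L : ℝ) ^ 2) + 24 * harm L := by
  set β := c - (1 - κ) * ρ with hβ
  have hdev : ∀ k ≤ L, dev ρ s' k = κ * dev ρ s k + β * k + e k := fun k hk => by
    unfold dev
    rw [(he k hk).2, hβ]
    ring
  have he2 : ∀ k ≤ L, e k ^ 2 ≤ 4 := fun k hk => by
    rw [← sq_abs]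
    calc _ ≤ (2 : ℝ) ^ 2 := by gcongr; exact (he k hk).1
      _ = 4 := by norm_num
  have hκ2 : κ ^ 2 ≤ 1 := pow_le_one₀ hκ0 hκ1
  have hleft : ∑ k ∈ range L, dev ρ s' (k + 1) ^ 2 / ((k : ℝ) + 1)
      ≤ ∑ k ∈ range L, (3 * (dev ρ s (k + 1) ^ 2 / ((k : ℝ) + 1)) + 3 * (β ^ 2 * L)
        + 12 * (1 / ((k : ℝ) + 1))) := by
    refine sum_le_sum fun k hk => ?_
    have hk' : (k : ℝ) + 1 ≤ L := by exact_mod_cast mem_range.1 hk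
    have hk0 : (0 : ℝ) < (k : ℝ) + 1 := by positivity
    rw [hdev _ (mem_range.1 hk), div_le_iff₀ hk0]
    push_cast
    have h1 := add_three_sq_le (κ * dev ρ s (k + 1)) (β * (k + 1)) (e (k + 1))
    have h2 := he2 _ (mem_range.1 hk)
    have h3 : (κ * dev ρ s (k + 1)) ^ 2 ≤ dev ρ s (k + 1) ^ 2 := by
      rw [mul_pow]; exact mul_le_of_le_one_left (sq_nonneg _) hκ2
    have h4 : (β * ((k : ℝ) + 1)) ^ 2 ≤ β ^ 2 * L * (k + 1) := by
      rw [mul_pow, sq ((k : ℝ) + 1), ← mul_assoc]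
      gcongr
    have h5 : (3 * (dev ρ s (k + 1) ^ 2 / ((k : ℝ) + 1)) + 3 * (β ^ 2 * L)
        + 12 * (1 / ((k : ℝ) + 1))) * (k + 1)
        = 3 * dev ρ s (k + 1) ^ 2 + 3 * (β ^ 2 * L * (k + 1)) + 12 := by
      field_simp
    linarith
  have hright : ∑ k ∈ range L, (dev ρ s' k - dev ρ s' L) ^ 2 / ((L : ℝ) - k)
      ≤ ∑ k ∈ range L, (3 * ((dev ρ s k - dev ρ s L) ^ 2 / ((L : ℝ) - k)) + 3 * (β ^ 2 * L)
        + 12 * (1 / ((L : ℝ) - k))) := by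
    refine sum_le_sum fun k hk => ?_
    have hk' := cast_sub_pos hk
    have hk0 : (0 : ℝ) < (L : ℝ) - k := by linarith
    have hkk : (0 : ℝ) ≤ k := k.cast_nonneg
    rw [hdev _ (mem_range.1 hk).le, hdev L le_rfl, heL, div_le_iff₀ hk0]
    have h1 := add_three_sq_le (κ * (dev ρ s k - dev ρ s L)) (-β * ((L : ℝ) - k)) (e k)
    have h2 := he2 _ (mem_range.1 hk).le
    have h3 : (κ * (dev ρ s k - dev ρ s L)) ^ 2 ≤ (dev ρ s k - dev ρ s L) ^ 2 := by
      rw [mul_pow]; exact mul_le_of_le_one_left (sq_nonneg _) hκ2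
    have h4 : (-β * ((L : ℝ) - k)) ^ 2 ≤ β ^ 2 * L * (L - k) := by
      rw [mul_pow, sq ((L : ℝ) - k), ← mul_assoc, neg_sq]
      gcongr
      linarith
    have h5 : (3 * ((dev ρ s k - dev ρ s L) ^ 2 / ((L : ℝ) - k)) + 3 * (β ^ 2 * L)
        + 12 * (1 / ((L : ℝ) - k))) * (L - k)
        = 3 * (dev ρ s k - dev ρ s L) ^ 2 + 3 * (β ^ 2 * L * (L - k)) + 12 := by
      field_simp
    rw [h5]
    rw [show κ * dev ρ s k + β * k + e k - (κ * dev ρ s L + β * L + 0)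
      = κ * (dev ρ s k - dev ρ s L) + -β * ((L : ℝ) - k) + e k by ring]
    linarith
  have hr := harm_reflect L
  simp only [sum_add_distrib, ← mul_sum, sum_const, card_range, nsmul_eq_mul] at hleft hright
  rw [hr] at hright
  have hh : ∑ i ∈ range L, 1 / ((i : ℝ) + 1) = harm L := rfl
  rw [hh] at hleft
  unfold edge
  rw [sq (L : ℝ)]
  linarith

end LocalOpt

namespace LocalOpt

open Finset

variable {ρ : ℝ} {s : ℕ → ℤ}

/-! ### Concatenation of blocks -/

theorem dev_shift (ρ : ℝ) (s : ℕ → ℤ) (u i : ℕ) :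
    dev ρ (fun t => s (u + t)) i = dev ρ s (u + i) - dev ρ s u := by
  unfold dev
  rw [ht_shift]
  push_cast
  ring

theorem pair_add_pair_le (hρ : |ρ| ≤ 1) (hs : IsStep s) (i j : ℕ) :
    pair ρ s i j + pair ρ s j i ≤ 80 * ((1 + (dev ρ s i - dev ρ s j) ^ 2) / gap i j ^ 2) := by
  have h1 := pair_le hρ hs i j
  have h2 := pair_le hρ hs j i
  rw [gap_comm j i, show (dev ρ s j - dev ρ s i) ^ 2 = (dev ρ s i - dev ρ s j) ^ 2 by ring] at h2
  rw [mul_div_assoc] at h1 h2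
  linarith

/-- The interaction of the blocks `k` and `l` of length `L`. -/
noncomputable def cross (ρ : ℝ) (s : ℕ → ℤ) (L k l : ℕ) : ℝ :=
  ∑ i ∈ range L, ∑ j ∈ range L,
    (pair ρ s (k * L + i) (l * L + j) + pair ρ s (l * L + j) (k * L + i))

/-- At least one block lies in between, so all gaps are at least `(d + 1) * L` and the mean squares
of the deviations, bounded by `Γ`, suffice. Here `49 = 1 + 3 * 16`. -/
theorem cross_far_le (hρ : |ρ| ≤ 1) (hs : IsStep s) {L : ℕ} (hL : 1 ≤ L) {Γ : ℝ}
    (hdev : ∀ k, |dev ρ s (k * L)| ≤ 2)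
    (hΓ : ∀ k, edge ρ (fun t => s (k * L + t)) L ≤ Γ) (k d : ℕ) :
    cross ρ s L k (k + d + 2) ≤ 80 * (49 + 6 * Γ) * (1 / ((d : ℝ) + 1) ^ 2) := by
  set l := k + d + 2 with hl
  have hLpos : (0 : ℝ) < L := by exact_mod_cast hL
  set γ : ℕ → ℕ → ℝ := fun k i => dev ρ (fun t => s (k * L + t)) i with hγ
  have hγs : ∀ k, ∑ i ∈ range L, γ k i ^ 2 ≤ L * Γ := fun k =>
    (sum_dev_sq_le ρ _ L).trans (mul_le_mul_of_nonneg_left (hΓ k) hLpos.le)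
  have hterm : ∀ i ∈ range L, ∀ j ∈ range L,
      pair ρ s (k * L + i) (l * L + j) + pair ρ s (l * L + j) (k * L + i)
        ≤ 80 * ((49 + 3 * γ k i ^ 2 + 3 * γ l j ^ 2) / (((d : ℝ) + 1) * L) ^ 2) := by
    intro i hi j hj
    refine (pair_add_pair_le hρ hs _ _).trans ?_
    have hgap : ((d : ℝ) + 1) * L ≤ gap (k * L + i) (l * L + j) := by
      have hle : k * L + i ≤ l * L + j := by
        have := mem_range.1 hi
        rw [hl]
        nlinarith
      rw [gap_of_le hle, hl]
      have hi' : (i : ℝ) ≤ L := by exact_mod_cast (mem_range.1 hi).le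
      have hj' : (0 : ℝ) ≤ j := j.cast_nonneg
      push_cast
      nlinarith
    have h1 : dev ρ s (k * L + i) = dev ρ s (k * L) + γ k i := by
      simp only [hγ]; rw [dev_shift]; ring
    have h2 : dev ρ s (l * L + j) = dev ρ s (l * L) + γ l j := by
      simp only [hγ]; rw [dev_shift]; ring
    have h3 : (dev ρ s (k * L) - dev ρ s (l * L)) ^ 2 ≤ 16 := by
      rw [← sq_abs]
      calc _ ≤ ((2 : ℝ) + 2) ^ 2 := by
            gcongr
            exact (abs_sub _ _).trans (add_le_add (hdev k) (hdev l))
        _ = 16 := by norm_num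
    have h4 := add_three_sq_le (dev ρ s (k * L) - dev ρ s (l * L)) (γ k i) (-γ l j)
    have hd0 : (0 : ℝ) < ((d : ℝ) + 1) * L := by positivity
    rw [h1, h2, show dev ρ s (k * L) + γ k i - (dev ρ s (l * L) + γ l j)
      = (dev ρ s (k * L) - dev ρ s (l * L)) + γ k i + -γ l j by ring]
    rw [neg_sq] at h4
    have h5 : 1 + (dev ρ s (k * L) - dev ρ s (l * L) + γ k i + -γ l j) ^ 2
        ≤ 49 + 3 * γ k i ^ 2 + 3 * γ l j ^ 2 := by linarith
    gcongr
  calc _ ≤ _ := sum_le_sum fun i hi => sum_le_sum fun j hj => hterm i hi j hj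
    _ = 80 * ((49 * (L : ℝ) ^ 2 + 3 * L * (∑ i ∈ range L, γ k i ^ 2)
          + 3 * L * (∑ j ∈ range L, γ l j ^ 2)) / (((d : ℝ) + 1) * L) ^ 2) := by
        simp only [← mul_sum, ← sum_div, sum_add_distrib, sum_const, card_range, nsmul_eq_mul]
        congr 2
        ring
    _ ≤ 80 * ((49 * (L : ℝ) ^ 2 + 3 * L * (L * Γ) + 3 * L * (L * Γ)) / (((d : ℝ) + 1) * L) ^ 2) := by
        gcongr
        · exact hγs k
        · exact hγs l
    _ = _ := by field_simp; ring

/-- The difference of deviations is split at the common end point. Summing the inverse squared gap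
over the index in the other block leaves the inverse distance to that end point, which is the weight
in `edge`. -/
theorem cross_adjacent_le (hρ : |ρ| ≤ 1) (hs : IsStep s) {L : ℕ} {Γ : ℝ}
    (hΓ : ∀ k, edge ρ (fun t => s (k * L + t)) L ≤ Γ) (k : ℕ) :
    cross ρ s L k (k + 1) ≤ 80 * (2 * harm L + 8 * Γ) := by
  set γ : ℕ → ℕ → ℝ := fun k i => dev ρ (fun t => s (k * L + t)) i with hγ
  set R : ℕ → ℝ := fun i => (γ k i - γ k L) ^ 2 with hR
  set F : ℕ → ℝ := fun j => γ (k + 1) j ^ 2 with hF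
  have hR0 : ∀ i, 0 ≤ R i := fun i => sq_nonneg _
  have hF0 : ∀ i, 0 ≤ F i := fun i => sq_nonneg _
  have hgap : ∀ i ∈ range L, ∀ j, gap (k * L + i) ((k + 1) * L + j) = ((L - i : ℕ) : ℝ) + j + 1 := by
    intro i hi j
    have := mem_range.1 hi
    rw [gap_of_le (by nlinarith), Nat.cast_sub this.le]
    push_cast
    ring
  have hterm : ∀ i ∈ range L, ∀ j ∈ range L,
      pair ρ s (k * L + i) ((k + 1) * L + j) + pair ρ s ((k + 1) * L + j) (k * L + i)
        ≤ 80 * ((1 + 2 * R i) * (1 / (((L - i : ℕ) : ℝ) + j + 1) ^ 2)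
          + 2 * F j * (1 / (((L - i : ℕ) : ℝ) + j + 1) ^ 2)) := by
    intro i hi j _
    refine (pair_add_pair_le hρ hs _ _).trans ?_
    rw [hgap i hi, ← add_mul, mul_one_div]
    have h1 : dev ρ s (k * L + i) - dev ρ s ((k + 1) * L + j)
        = (γ k i - γ k L) - γ (k + 1) j := by
      simp only [hγ]
      rw [dev_shift, dev_shift, dev_shift, show k * L + L = (k + 1) * L by ring]
      ring
    rw [h1]
    have h2 := sub_sq_le (γ k i - γ k L) (γ (k + 1) j)
    have h3 : 1 + (γ k i - γ k L - γ (k + 1) j) ^ 2 ≤ 1 + 2 * R i + 2 * F j := by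
      simp only [hR, hF]; linarith
    gcongr
  have hrow : ∀ i ∈ range L, ∑ j ∈ range L, (1 + 2 * R i) * (1 / (((L - i : ℕ) : ℝ) + j + 1) ^ 2)
      ≤ 2 * (1 / ((L : ℝ) - i)) + 4 * (R i / ((L : ℝ) - i)) := by
    intro i hi
    have h1 := cast_sub_pos hi
    have h2 : 2 / (((L - i : ℕ) : ℝ) + 1) ≤ 2 / ((L : ℝ) - i) := by
      rw [Nat.cast_sub (mem_range.1 hi).le]
      exact div_le_div_of_nonneg_left (by norm_num) (by linarith) (by linarith)
    have h3 := hR0 i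
    rw [← mul_sum]
    calc _ ≤ (1 + 2 * R i) * (2 / ((L : ℝ) - i)) := by
          gcongr
          exact (sum_inv_sq_shift_le _ _).trans h2
      _ = _ := by ring
  have hcol : ∀ j ∈ range L, ∑ i ∈ range L, 2 * F j * (1 / (((L - i : ℕ) : ℝ) + j + 1) ^ 2)
      ≤ 4 * (F j / ((j : ℝ) + 1)) := by
    intro j _
    have h3 := hF0 j
    rw [← mul_sum, ← sum_range_reflect]
    have h1 : ∑ r ∈ range L, 1 / (((L - (L - 1 - r) : ℕ) : ℝ) + j + 1) ^ 2
        ≤ 2 / ((j : ℝ) + 1) := by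
      refine le_trans (sum_le_sum fun r hr => ?_) (sum_inv_sq_shift_le j L)
      have := mem_range.1 hr
      rw [show L - (L - 1 - r) = r + 1 by omega]
      push_cast
      refine one_div_le_one_div_of_le (by positivity) ?_
      gcongr ?_ ^ 2
      linarith
    calc _ ≤ 2 * F j * (2 / ((j : ℝ) + 1)) := by gcongr
      _ = _ := by ring
  have hRs : ∑ i ∈ range L, R i / ((L : ℝ) - i) ≤ Γ := (edge_right_le ρ _ L).trans (hΓ k)
  have hFs : ∑ j ∈ range L, F j / ((j : ℝ) + 1) ≤ Γ := (sum_dev_sq_div_le ρ _ L).trans (hΓ (k + 1))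
  calc _ ≤ _ := sum_le_sum fun i hi => sum_le_sum fun j hj => hterm i hi j hj
    _ = 80 * ((∑ i ∈ range L, ∑ j ∈ range L, (1 + 2 * R i) * (1 / (((L - i : ℕ) : ℝ) + j + 1) ^ 2))
        + ∑ j ∈ range L, ∑ i ∈ range L, 2 * F j * (1 / (((L - i : ℕ) : ℝ) + j + 1) ^ 2)) := by
        rw [sum_comm (s := range L) (t := range L)
          (f := fun j i => 2 * F j * (1 / (((L - i : ℕ) : ℝ) + j + 1) ^ 2)), ← sum_add_distrib, mul_sum]
        refine sum_congr rfl fun i _ => ?_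
        rw [← sum_add_distrib, mul_sum]
    _ ≤ 80 * ((∑ i ∈ range L, (2 * (1 / ((L : ℝ) - i)) + 4 * (R i / ((L : ℝ) - i))))
        + ∑ j ∈ range L, 4 * (F j / ((j : ℝ) + 1))) := by
        gcongr with i hi j hj
        · exact hrow i hi
        · exact hcol j hj
    _ ≤ 80 * ((2 * harm L + 4 * Γ) + 4 * Γ) := by
        rw [sum_add_distrib, ← mul_sum, ← mul_sum, ← mul_sum, harm_reflect]
        gcongr
    _ = _ := by ring

theorem sum_range_mul (K L : ℕ) (g : ℕ → ℝ) :
    ∑ a ∈ range (K * L), g a = ∑ k ∈ range K, ∑ i ∈ range L, g (k * L + i) := by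
  induction K with
  | zero => simp
  | succ K ih => rw [add_mul, one_mul, sum_range_add, ih, sum_range_succ]

theorem sum_cross_le (hρ : |ρ| ≤ 1) (hs : IsStep s) {L : ℕ} (hL : 1 ≤ L) {Γ : ℝ}
    (hdev : ∀ k, |dev ρ s (k * L)| ≤ 2)
    (hΓ : ∀ k, edge ρ (fun t => s (k * L + t)) L ≤ Γ) (K : ℕ) :
    ∑ k ∈ range K, cross ρ s L k K ≤ 8000 * harm L + 1600 * Γ := by
  have hΓ0 : 0 ≤ Γ := (edge_nonneg _ _ _).trans (hΓ 0)
  have hH := one_le_harm hL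
  rcases K with _ | K
  · simp only [range_zero, sum_empty]
    positivity
  rw [sum_range_succ]
  have h1 := cross_adjacent_le hρ hs hΓ K
  have h2 : ∑ k ∈ range K, cross ρ s L k (K + 1) ≤ 80 * (49 + 6 * Γ) * 2 := by
    rw [← sum_range_reflect]
    calc _ ≤ ∑ d ∈ range K, 80 * (49 + 6 * Γ) * (1 / ((d : ℝ) + 1) ^ 2) := by
          refine sum_le_sum fun d hd => ?_
          have hd' := mem_range.1 hd
          have := cross_far_le hρ hs hL hdev hΓ (K - 1 - d) d
          rwa [show K - 1 - d + d + 2 = K + 1 by omega] at this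
      _ ≤ _ := by
          rw [← mul_sum]
          gcongr
          have := sum_inv_sq_shift_le 0 K
          simpa using this
  linarith

theorem E_concat_le (hρ : |ρ| ≤ 1) (hs : IsStep s) {L : ℕ} (hL : 1 ≤ L) {Γ X : ℝ}
    (hdev : ∀ k, |dev ρ s (k * L)| ≤ 2)
    (hΓ : ∀ k, edge ρ (fun t => s (k * L + t)) L ≤ Γ)
    (hX : ∀ k, E ρ (fun t => s (k * L + t)) L ≤ X) (K : ℕ) :
    E ρ s (K * L) ≤ K * (X + (8000 * harm L + 1600 * Γ)) := by
  induction K with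
  | zero => simp [E]
  | succ K ih =>
    rw [add_mul, one_mul, E_add, sum_range_mul K L fun a => ∑ j ∈ range L,
      (pair ρ s a (K * L + j) + pair ρ s (K * L + j) a)]
    have h1 := sum_cross_le hρ hs hL hdev hΓ K
    have h2 := hX K
    unfold cross at h1
    push_cast
    linarith

end LocalOpt

namespace LocalOpt

open Finset

variable {ρ : ℝ} {s : ℕ → ℤ}

/-! ### Long paths made of corrected copies of one block -/

theorem dev_congr {s' : ℕ → ℤ} {n i : ℕ} (h : ∀ t < n, s t = s' t) (hi : i ≤ n) :
    dev ρ s i = dev ρ s' i := by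
  unfold dev
  rw [ht_congr h hi]

theorem edge_congr {s' : ℕ → ℤ} {L : ℕ} (h : ∀ t < L, s t = s' t) : edge ρ s L = edge ρ s' L := by
  unfold edge
  congr 1
  · refine sum_congr rfl fun k hk => ?_
    rw [dev_congr h (mem_range.1 hk)]
  · refine sum_congr rfl fun k hk => ?_
    rw [dev_congr h (mem_range.1 hk).le, dev_congr h le_rfl]

/-- The end deviation `D` governs both costs: the slope change has `β * L` of order `|D| + 1`, and
at most `|D| / 2 + 1` steps change, each at a price of order `w`. Since `D ^ 2 ≤ 4 * edge`, Young's
inequality for `w * |D|` leaves only `edge` and `w ^ 2`. -/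
theorem exists_corrected_block (hρ : |ρ| ≤ 1) (hs : IsStep s) {L V : ℕ} (hL : 1 ≤ L) (hV : V ≤ L)
    (hVρ : |2 * (V : ℝ) - L - ρ * L| ≤ 2) {m w : ℝ} (hm : 0 < m) (hm1 : m ≤ 1) (hw1 : 1 ≤ w)
    (hw : harm L / m ≤ w) :
    ∃ s', IsStep s' ∧ ht s' L = 2 * V - L ∧ edge ρ s' L ≤ 51 * edge ρ s L + 72 * w ^ 2 ∧
      E ρ s' L ≤ (1 + m) * E ρ s L + 1 / 8 * tilt ρ s L + 476 * edge ρ s L + 592 * w ^ 2 := by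
  obtain ⟨s', κ, c, e, hs', hκ0, hκ1, hc, he, heL, hend, hM⟩ := exists_thinning hs hV
  refine ⟨s', hs', hend, ?_⟩
  have hend' : dev ρ s' L = 2 * (V : ℝ) - L - ρ * L := by
    unfold dev
    rw [hend]
    push_cast
    ring
  rw [← hend'] at hVρ
  have hD := dev_sq_le_edge ρ s hL
  have hedge := edge_nonneg ρ s L
  set D := dev ρ s L with hDdef
  set β := c - (1 - κ) * ρ with hβ
  have hβL : β * L = dev ρ s' L - κ * D := by
    rw [hDdef]
    unfold dev
    rw [(he L le_rfl).2, heL, hβ]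
    ring
  have hβ2 : β ^ 2 * (L : ℝ) ^ 2 ≤ 8 * edge ρ s L + 8 := by
    have h1 : (κ * D) ^ 2 ≤ D ^ 2 := by
      rw [mul_pow]
      exact mul_le_of_le_one_left (sq_nonneg _) (pow_le_one₀ hκ0 hκ1)
    have h2 : dev ρ s' L ^ 2 ≤ 4 := by
      rw [← sq_abs]
      calc _ ≤ (2 : ℝ) ^ 2 := by gcongr
        _ = 4 := by norm_num
    rw [← mul_pow, hβL]
    linarith [sub_sq_le (dev ρ s' L) (κ * D)]
  have hMD : ∑ t ∈ range L, differ s s' t ≤ |D| / 2 + 1 := by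
    refine hM.trans ?_
    have : (ht s L : ℝ) - ht s' L = D - dev ρ s' L := by
      rw [hDdef]; unfold dev; ring
    rw [this]
    linarith [abs_sub D (dev ρ s' L)]
  have hH0 := harm_nonneg L
  have hHw : harm L ≤ w := le_trans (le_div_self hH0 hm hm1) hw
  have hw2 : w ≤ w ^ 2 := by nlinarith
  have h1 := E_le_correct hρ hs hs' hκ0 hκ1 hc he hm hm1
  have h2 := edge_le_correct (ρ := ρ) hκ0 hκ1 he heL
  rw [← hβ] at h1 h2
  constructor
  · linarith
  · have h3 : 432 * harm L / m + 32 ≤ 464 * w := by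
      rw [mul_div_assoc]
      linarith
    have h4 : (432 * harm L / m + 32) * ∑ t ∈ range L, differ s s' t ≤ 464 * w * (|D| / 2 + 1) :=
      mul_le_mul h3 hMD (sum_nonneg fun t _ => differ_nonneg s s' t) (by positivity)
    have h5 : w * |D| ≤ (w ^ 2 + D ^ 2) / 2 := by
      rw [← sq_abs D]
      linarith [sq_nonneg (w - |D|), show (w - |D|) ^ 2 = w ^ 2 + |D| ^ 2 - 2 * (w * |D|) by ring]
    linarith [show 464 * w * (|D| / 2 + 1) = 232 * (w * |D|) + 464 * w by ring]

theorem minE_mul_le (hρ : |ρ| ≤ 1) (hs : IsStep s) {L : ℕ} (hL : 1 ≤ L) {m w : ℝ} (hm : 0 < m)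
    (hm1 : m ≤ 1) (hw1 : 1 ≤ w) (hw : harm L / m ≤ w) (K : ℕ) :
    minE ρ (K * L) ≤ K * ((1 + m) * E ρ s L + 1 / 8 * tilt ρ s L + 100000 * edge ρ s L
      + 200000 * w ^ 2) := by
  have hρ' := abs_le.1 hρ
  set x : ℝ := (1 + ρ) * L / 2 with hx
  have hL0 : (0 : ℝ) ≤ L := L.cast_nonneg
  have hx0 : 0 ≤ x := by
    have : 0 ≤ 1 + ρ := by linarith
    positivity
  have hxL : x ≤ L := by
    rw [hx, div_le_iff₀ two_pos, mul_comm]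
    exact mul_le_mul_of_nonneg_left (by linarith) hL0
  -- `x` is the ideal number of up-steps per block. Rounding the cumulative count, and not that of
  -- each block, keeps the errors at block ends from accumulating.
  set N : ℕ → ℕ := fun k => ⌊(k : ℝ) * x⌋₊ with hN
  have hN1 : ∀ k : ℕ, (N k : ℝ) ≤ k * x := fun k => Nat.floor_le (by positivity)
  have hN2 : ∀ k : ℕ, (k : ℝ) * x < N k + 1 := fun k => Nat.lt_floor_add_one _
  have hNmono : ∀ k, N k ≤ N (k + 1) := fun k => Nat.floor_le_floor (by push_cast; nlinarith)
  have hVR : ∀ k, ((N (k + 1) - N k : ℕ) : ℝ) = N (k + 1) - N k := fun k => Nat.cast_sub (hNmono k)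
  have hVL : ∀ k, N (k + 1) - N k ≤ L := by
    intro k
    have h1 := hN1 (k + 1)
    have h2 := hN2 k
    push_cast at h1
    have : (N (k + 1) : ℝ) < N k + 1 + L := by linarith
    have : N (k + 1) < N k + 1 + L := by exact_mod_cast this
    omega
  have hVρ : ∀ k, |2 * ((N (k + 1) - N k : ℕ) : ℝ) - L - ρ * L| ≤ 2 := by
    intro k
    have h1 := hN1 (k + 1)
    have h2 := hN2 k
    have h3 := hN2 (k + 1)
    have h4 := hN1 k
    have h5 : 2 * x = L + ρ * L := by rw [hx]; ring
    push_cast at h1 h3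
    rw [hVR, abs_le]
    constructor <;> linarith
  choose b hbstep hbend hbedge hbE using fun k =>
    exists_corrected_block hρ hs hL (hVL k) (hVρ k) hm hm1 hw1 hw
  set S : ℕ → ℤ := fun t => b (t / L) (t % L) with hS
  have hSstep : IsStep S := fun t => hbstep _ _
  have hSblock : ∀ k, ∀ t < L, S (k * L + t) = b k t := by
    intro k t ht
    simp only [hS]
    rw [Nat.add_comm, Nat.add_mul_div_right _ _ hL, Nat.div_eq_of_lt ht, Nat.add_mul_mod_self_right,
      Nat.mod_eq_of_lt ht, zero_add]
  have hSht : ∀ k, ht S (k * L) = 2 * N k - k * L := by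
    intro k
    induction k with
    | zero => simp [ht, hN]
    | succ k ih =>
      have h1 := ht_shift S (k * L) L
      rw [ht_congr (hSblock k) le_rfl, hbend, Nat.cast_sub (hNmono k), ih] at h1
      rw [add_mul, one_mul]
      push_cast
      linarith
  have hdev : ∀ k, |dev ρ S (k * L)| ≤ 2 := by
    intro k
    have h1 := hN1 k
    have h2 := hN2 k
    have h3 : dev ρ S (k * L) = 2 * ((N k : ℝ) - k * x) := by
      unfold dev
      rw [hSht, hx]
      push_cast
      ring
    rw [h3, abs_le]
    constructor <;> linarith
  have hmain := E_concat_le hρ hSstep hL hdev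
    (fun k => (edge_congr (hSblock k)).trans_le (hbedge k))
    (fun k => (E_congr (hSblock k)).trans_le (hbE k)) K
  refine (minE_le _ ρ hSstep).trans (hmain.trans ?_)
  have hH0 := harm_nonneg L
  have hHw : harm L ≤ w := le_trans (le_div_self hH0 hm hm1) hw
  have hw2 : w ≤ w ^ 2 := by nlinarith
  have := edge_nonneg ρ s L
  refine mul_le_mul_of_nonneg_left ?_ K.cast_nonneg
  linarith

/-- Blocks of a single step already give a bound that is linear in `n` and uniform in `ρ`. -/
theorem minE_le_linear (hρ : |ρ| ≤ 1) (n : ℕ) : minE ρ n ≤ 2000000 * n := by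
  have hs : IsStep fun _ => 1 := fun _ => Or.inl rfl
  have h := minE_mul_le hρ hs (L := 1) le_rfl (m := 1) (w := 1) one_pos le_rfl le_rfl
    (by simp [harm]) n
  have hp := pair_le hρ hs 0 0
  have hg : gap 0 0 = 1 := by simp [gap]
  have hE : E ρ (fun _ => 1) 1 ≤ 40 := by
    rw [hg] at hp
    simpa [E] using hp
  have hW := W_le hρ hs 0 0
  have hT : tilt ρ (fun _ => 1) 1 ≤ 288 := by
    rw [hg] at hW
    simpa [tilt, hg] using hW
  have hd : dev ρ (fun _ => 1) 1 ^ 2 ≤ 4 := by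
    have := abs_le.1 hρ
    simp only [dev, ht, sum_range_one]
    norm_num
    nlinarith
  have hB : edge ρ (fun _ => 1) 1 ≤ 8 := by
    simp only [edge, sum_range_one, dev_zero]
    norm_num
    linarith
  rw [mul_one] at h
  have hn : (0 : ℝ) ≤ n := n.cast_nonneg
  refine h.trans ?_
  rw [mul_comm]
  gcongr
  linarith

end LocalOpt

namespace LocalOpt

open Finset Filter Topology

variable {ρ : ℝ} {s : ℕ → ℤ}

/-! ### The limit of the optimal energies -/

/-- Fekete's lemma for the subadditive sequence `-minE ρ n`. -/
theorem exists_density (hρ : |ρ| ≤ 1) :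
    ∃ σ : ℝ, Tendsto (fun n : ℕ => minE ρ n / n) atTop (𝓝 σ) ∧ ∀ n : ℕ, minE ρ n / n ≤ σ := by
  have hsub : Subadditive fun n => -minE ρ n := fun m n => by
    linarith [minE_superadd ρ m n]
  have hbdd : BddBelow (Set.range fun n : ℕ => -minE ρ n / n) := by
    refine ⟨-2000000, ?_⟩
    rintro _ ⟨n, rfl⟩
    simp only
    rw [neg_div, neg_le_neg_iff]
    exact div_le_of_le_mul₀ n.cast_nonneg (by norm_num) (minE_le_linear hρ n)
  have hlim := hsub.tendsto_lim hbdd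
  have h0 : hsub.lim ≤ 0 := le_of_tendsto hlim <| Eventually.of_forall fun n => by
    rw [neg_div, neg_nonpos]
    exact div_nonneg (minE_nonneg n ρ) n.cast_nonneg
  refine ⟨-hsub.lim, ?_, fun n => ?_⟩
  · refine hlim.neg.congr fun n => ?_
    ring
  · rcases Nat.eq_zero_or_pos n with rfl | hn
    · simpa using h0
    · have := hsub.lim_le_div hbdd hn.ne'
      rw [neg_div] at this
      linarith

/-! ### Averaging over windows and over scales -/

/-- The interactions at distances of order at most `L`. -/
noncomputable def shortW (ρ : ℝ) (s : ℕ → ℤ) (L a b : ℕ) : ℝ :=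
  if gap a b ≤ 2 * L then √(gap a b / L) * W ρ s a b else 0

theorem shortW_nonneg (ρ : ℝ) (s : ℕ → ℤ) (L a b : ℕ) : 0 ≤ shortW ρ s L a b := by
  unfold shortW
  have := W_nonneg ρ s a b
  split_ifs <;> positivity

/-- A geometric series that starts at the first `j` with `x ≤ 2 * 4 ^ j`, with first term at most 2.
The two-case invariant records whether it has started. -/
theorem sum_scales_le {x : ℝ} (hx : 0 ≤ x) (m : ℕ) :
    ∑ j ∈ range m, (if x ≤ 2 * 4 ^ j then x / 4 ^ j else 0) ≤ 3 := by
  have key : (∑ j ∈ range m, (if x ≤ 2 * 4 ^ j then x / 4 ^ j else 0) = 0) ∨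
      ∑ j ∈ range m, (if x ≤ 2 * 4 ^ j then x / 4 ^ j else 0) ≤ 8 / 3 - 4 / 3 * (x / 4 ^ m) := by
    induction m with
    | zero => left; simp
    | succ m ih =>
      rw [sum_range_succ]
      have h4 : x / 4 ^ (m + 1) = x / 4 ^ m / 4 := by rw [pow_succ]; field_simp
      rw [h4]
      split_ifs with h
      · right
        have hy : x / 4 ^ m ≤ 2 := by rwa [div_le_iff₀ (by positivity)]
        rcases ih with ih | ih
        · rw [ih]; linarith
        · linarith
      · rcases ih with ih | ih
        · left; rw [ih, add_zero]
        · right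
          have : 0 ≤ x / 4 ^ m := by positivity
          linarith
  have : 0 ≤ x / 4 ^ m := by positivity
  rcases key with h | h
  · rw [h]; norm_num
  · linarith

/-- At scale `16 ^ j` the weight is `√gap / 4 ^ j`, so `sum_scales_le` applies with `x = √gap`. -/
theorem sum_shortW_le (ρ : ℝ) (s : ℕ → ℤ) (m a b : ℕ) :
    ∑ j ∈ range m, shortW ρ s (16 ^ j) a b ≤ 3 * W ρ s a b := by
  have hW := W_nonneg ρ s a b
  have hg := gap_pos a b
  refine le_trans ?_ (mul_le_mul_of_nonneg_right (sum_scales_le (Real.sqrt_nonneg (gap a b)) m) hW)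
  rw [sum_mul]
  refine sum_le_sum fun j _ => ?_
  have h16 : ((16 ^ j : ℕ) : ℝ) = (4 ^ j) ^ 2 := by
    push_cast
    rw [← pow_mul, mul_comm, pow_mul]
    norm_num
  have h4 : (0 : ℝ) < 4 ^ j := by positivity
  unfold shortW
  rw [h16]
  by_cases h : gap a b ≤ 2 * (4 ^ j) ^ 2
  · have h' : √(gap a b) ≤ 2 * 4 ^ j := by
      rw [Real.sqrt_le_left (by positivity)]
      nlinarith [sq_nonneg ((4 : ℝ) ^ j)]
    rw [if_pos h, if_pos h', Real.sqrt_div hg.le, Real.sqrt_sq h4.le]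
  · rw [if_neg h]
    split_ifs <;> positivity

theorem sum_tilt_windows_le (ρ : ℝ) (s : ℕ → ℤ) {n L : ℕ} (hLn : L ≤ n) :
    ∑ u ∈ range (n - L), tilt ρ (fun t => s (u + t)) L
      ≤ L * ∑ a ∈ range n, ∑ b ∈ range n, shortW ρ s L a b := by
  refine le_trans (sum_le_sum fun u _ => ?_)
    (sum_windows_le (c := shortW ρ s L) (shortW_nonneg ρ s L) (K := n - L) (by omega))
  refine sum_le_sum fun i hi => sum_le_sum fun j hj => le_of_eq ?_
  have h1 := gap_le (mem_range.1 hi) (mem_range.1 hj)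
  have h2 : (0 : ℝ) ≤ L := L.cast_nonneg
  unfold shortW
  rw [gap_shift, if_pos (by linarith), W_shift]

theorem sum_E_windows_le (ρ : ℝ) (s : ℕ → ℤ) {n L : ℕ} (hLn : L ≤ n) :
    ∑ u ∈ range (n - L), E ρ (fun t => s (u + t)) L ≤ L * E ρ s n := by
  refine le_trans (le_of_eq (sum_congr rfl fun u _ => ?_))
    (sum_windows_le (c := pair ρ s) (pair_nonneg ρ s) (K := n - L) (by omega))
  unfold E
  simp only [pair_shift]

/-- With `gap = L * q ^ 2` and `q ≤ 2`, one has `gap ^ 2 / r ≤ 2 * gap ≤ 4 * L * q`, and `q` is the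
weight in `shortW`. -/
theorem dev_sq_div_le (hρ : |ρ| ≤ 1) (hs : IsStep s) {L i j : ℕ} {r : ℝ} (hL : 1 ≤ L) (hr : 0 < r)
    (h1 : gap i j ≤ 2 * L) (h2 : gap i j ≤ 2 * r) :
    (dev ρ s i - dev ρ s j) ^ 2 / r ≤ 8 * L * shortW ρ s L i j + 32 * (1 / r) := by
  have hd := dev_sub_sq_le hρ hs i j
  have hg := gap_pos i j
  have hW := W_nonneg ρ s i j
  have hLpos : (0 : ℝ) < L := by exact_mod_cast hL
  unfold shortW
  rw [if_pos h1]
  set q := √(gap i j / L) with hq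
  have hq0 : 0 ≤ q := Real.sqrt_nonneg _
  have hq2 : gap i j = L * q ^ 2 := by
    rw [hq, Real.sq_sqrt (by positivity)]
    field_simp
  have hq3 : q ≤ 2 := by
    have : q ^ 2 ≤ 2 ^ 2 := by
      have : (L : ℝ) * q ^ 2 ≤ L * 2 := by rw [← hq2]; linarith
      linarith [le_of_mul_le_mul_left this hLpos]
    exact abs_le_of_sq_le_sq' this (by norm_num) |>.2
  rw [div_le_iff₀ hr]
  have h3 : (8 * L * (q * W ρ s i j) + 32 * (1 / r)) * r = 8 * L * q * r * W ρ s i j + 32 := by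
    field_simp
  rw [h3]
  have h4 : gap i j ^ 2 ≤ 4 * L * q * r := by
    calc gap i j ^ 2 = gap i j * (L * q ^ 2) := by rw [← hq2]; ring
      _ ≤ (2 * r) * (L * (q * 2)) := by
          rw [sq q]
          gcongr
      _ = _ := by ring
  have h5 := mul_le_mul_of_nonneg_right h4 hW
  linarith

/-- The end points of different windows select different columns of the `shortW` array, so the left
ends use each entry at most once, and so do the right ends. The gaps reach `L + 1`, hence the cutoff
at `2 * L`; the index `u + L` must stay below `n`, hence only `n - L` windows. -/
theorem sum_edge_windows_le (hρ : |ρ| ≤ 1) (hs : IsStep s) {n L : ℕ} (hL : 1 ≤ L) (hLn : L ≤ n) :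
    ∑ u ∈ range (n - L), edge ρ (fun t => s (u + t)) L
      ≤ 16 * L * (∑ a ∈ range n, ∑ b ∈ range n, shortW ρ s L a b) + 64 * n * harm L := by
  have hc := shortW_nonneg ρ s L
  have hL1 : (1 : ℝ) ≤ L := by exact_mod_cast hL
  have hH := harm_nonneg L
  have hleft : ∀ u ∈ range (n - L), ∑ k ∈ range L, dev ρ (fun t => s (u + t)) (k + 1) ^ 2 / ((k : ℝ) + 1)
      ≤ 8 * L * (∑ a ∈ range n, shortW ρ s L a u) + 32 * harm L := by
    intro u hu
    have hu' := mem_range.1 hu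
    calc _ ≤ ∑ k ∈ range L, (8 * L * shortW ρ s L (u + 1 + k) u + 32 * (1 / ((k : ℝ) + 1))) := by
          refine sum_le_sum fun k hk => ?_
          have hk' : (k : ℝ) + 1 ≤ L := by exact_mod_cast mem_range.1 hk
          have hk0 : (0 : ℝ) ≤ k := k.cast_nonneg
          have hgap : gap (u + 1 + k) u = k + 2 := by
            rw [gap_comm, gap_of_le (by omega)]; push_cast; ring
          rw [dev_shift, show u + (k + 1) = u + 1 + k by ring]
          exact dev_sq_div_le hρ hs hL (by positivity) (by rw [hgap]; linarith) (by rw [hgap]; linarith)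
      _ ≤ _ := by
          rw [sum_add_distrib, ← mul_sum, ← mul_sum]
          refine add_le_add ?_ le_rfl
          gcongr
          exact sum_shift_le (c := fun a => shortW ρ s L a u) (fun _ => hc _ _) (by omega)
  have hright : ∀ u ∈ range (n - L),
      ∑ k ∈ range L, (dev ρ (fun t => s (u + t)) k - dev ρ (fun t => s (u + t)) L) ^ 2 / ((L : ℝ) - k)
      ≤ 8 * L * (∑ a ∈ range n, shortW ρ s L a (L + u)) + 32 * harm L := by
    intro u hu
    have hu' := mem_range.1 hu
    calc _ ≤ ∑ k ∈ range L, (8 * L * shortW ρ s L (u + k) (L + u) + 32 * (1 / ((L : ℝ) - k))) := by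
          refine sum_le_sum fun k hk => ?_
          have hk' := cast_sub_pos hk
          have hkL := mem_range.1 hk
          have hk0 : (0 : ℝ) ≤ k := k.cast_nonneg
          have hgap : gap (u + k) (L + u) = L - k + 1 := by
            rw [gap_of_le (by omega)]; push_cast; ring
          rw [dev_shift, dev_shift, sub_sub_sub_cancel_right, add_comm u L]
          exact dev_sq_div_le hρ hs hL (by linarith) (by rw [hgap]; linarith) (by rw [hgap]; linarith)
      _ ≤ _ := by
          rw [sum_add_distrib, ← mul_sum, ← mul_sum, harm_reflect]
          refine add_le_add ?_ le_rfl
          gcongr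
          exact sum_shift_le (c := fun a => shortW ρ s L a (L + u)) (fun _ => hc _ _) (by omega)
  set C := ∑ a ∈ range n, ∑ b ∈ range n, shortW ρ s L a b with hC
  have hC' : C = ∑ b ∈ range n, ∑ a ∈ range n, shortW ρ s L a b := sum_comm
  have hl : ∑ u ∈ range (n - L), ∑ a ∈ range n, shortW ρ s L a u ≤ C := by
    rw [hC']
    exact sum_le_sum_of_subset_of_nonneg (range_mono (Nat.sub_le _ _))
      fun _ _ _ => sum_nonneg fun _ _ => hc _ _
  have hr : ∑ u ∈ range (n - L), ∑ a ∈ range n, shortW ρ s L a (L + u) ≤ C := by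
    rw [hC']
    exact sum_shift_le (c := fun b => ∑ a ∈ range n, shortW ρ s L a b)
      (fun _ => sum_nonneg fun _ _ => hc _ _) (by omega)
  have hnL : ((n - L : ℕ) : ℝ) ≤ n := by exact_mod_cast Nat.sub_le _ _
  calc _ ≤ ∑ u ∈ range (n - L), ((8 * L * (∑ a ∈ range n, shortW ρ s L a u) + 32 * harm L)
        + (8 * L * (∑ a ∈ range n, shortW ρ s L a (L + u)) + 32 * harm L)) :=
        sum_le_sum fun u hu => add_le_add (hleft u hu) (hright u hu)
    _ = 8 * L * (∑ u ∈ range (n - L), ∑ a ∈ range n, shortW ρ s L a u)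
        + 8 * L * (∑ u ∈ range (n - L), ∑ a ∈ range n, shortW ρ s L a (L + u))
        + 64 * ((n - L : ℕ) : ℝ) * harm L := by
        simp only [sum_add_distrib, ← mul_sum, sum_const, card_range, nsmul_eq_mul]
        ring
    _ ≤ 8 * L * C + 8 * L * C + 64 * n * harm L := by gcongr
    _ = _ := by ring

theorem harm_two_mul_le (L : ℕ) : harm (2 * L) ≤ harm L + 1 := by
  unfold harm
  rw [two_mul, sum_range_add]
  gcongr
  calc _ ≤ ∑ r ∈ range L, 1 / ((L : ℝ) + 1) := by
        refine sum_le_sum fun r _ => one_div_le_one_div_of_le (by positivity) ?_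
        push_cast
        linarith [(r.cast_nonneg : (0 : ℝ) ≤ r)]
    _ ≤ 1 := by
        rw [sum_const, card_range, nsmul_eq_mul, mul_one_div]
        exact div_le_one_of_le₀ (by linarith) (by positivity)

theorem harm_pow_le (j : ℕ) : harm (16 ^ j) ≤ 4 * j + 1 := by
  induction j with
  | zero => simp [harm]
  | succ j ih =>
    have h1 := harm_two_mul_le (16 ^ j)
    have h2 := harm_two_mul_le (2 * 16 ^ j)
    have h3 := harm_two_mul_le (2 * (2 * 16 ^ j))
    have h4 := harm_two_mul_le (2 * (2 * (2 * 16 ^ j)))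
    rw [show 2 * (2 * (2 * (2 * 16 ^ j))) = 16 ^ (j + 1) by ring] at h4
    push_cast
    linarith

theorem cube_le_four_pow (j : ℕ) : j ^ 3 ≤ 4 ^ j := by
  rcases Nat.lt_or_ge j 2 with h | h
  · interval_cases j <;> norm_num
  · induction j, h using Nat.le_induction with
    | base => norm_num
    | succ j hj ih =>
      obtain ⟨k, rfl⟩ := Nat.exists_eq_add_of_le hj
      have : (2 + k + 1) ^ 3 ≤ 4 * (2 + k) ^ 3 := by
        linarith [Nat.zero_le (k ^ 3), Nat.zero_le (k ^ 2),
          show 4 * (2 + k) ^ 3 = (2 + k + 1) ^ 3 + (3 * k ^ 3 + 15 * k ^ 2 + 21 * k + 5) by ring]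
      rw [pow_succ 4]
      linarith

/-- The density is bounded by a window of length `L` in an optimal path of length `n`. -/
theorem density_le_of_scale (hρ : |ρ| ≤ 1) (hs : IsStep s) {σ : ℝ}
    (hσ : Tendsto (fun n : ℕ => minE ρ n / n) atTop (𝓝 σ)) {n L : ℕ} (hL : 1 ≤ L) (hLn : L < n)
    {m w : ℝ} (hm : 0 < m) (hm1 : m ≤ 1) (hw1 : 1 ≤ w) (hw : harm L / m ≤ w) :
    σ ≤ ((1 + m) * E ρ s n + 1700000 * (∑ a ∈ range n, ∑ b ∈ range n, shortW ρ s L a b)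
      + 6400000 * n * (harm L / L)) / (n - L) + 200000 * w ^ 2 / L := by
  have hLpos : (0 : ℝ) < L := by exact_mod_cast hL
  have hnL : (0 : ℝ) < (n : ℝ) - L := by
    have : (L : ℝ) < n := by exact_mod_cast hLn
    linarith
  set C := ∑ a ∈ range n, ∑ b ∈ range n, shortW ρ s L a b with hC
  have hC0 : 0 ≤ C := sum_nonneg fun _ _ => sum_nonneg fun _ _ => shortW_nonneg _ _ _ _ _
  set X : ℕ → ℝ := fun u => (1 + m) * E ρ (fun t => s (u + t)) L
    + 1 / 8 * tilt ρ (fun t => s (u + t)) L + 100000 * edge ρ (fun t => s (u + t)) L with hX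
  set Y : ℝ := (1 + m) * E ρ s n + 1700000 * C + 6400000 * n * (harm L / L) with hY
  have hsum : ∑ u ∈ range (n - L), X u ≤ L * Y := by
    have h1 := sum_E_windows_le ρ s hLn.le
    have h2 := sum_tilt_windows_le ρ s hLn.le
    have h3 := sum_edge_windows_le hρ hs hL hLn.le
    rw [← hC] at h2 h3
    have h4 : (L : ℝ) * Y
        = (1 + m) * (L * E ρ s n) + 1700000 * (L * C) + 6400000 * n * harm L := by
      rw [hY]; field_simp
    rw [h4]
    simp only [hX, sum_add_distrib, ← mul_sum]
    have h5 := mul_le_mul_of_nonneg_left h1 (by linarith : 0 ≤ 1 + m)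
    have h6 : 0 ≤ (L : ℝ) * C := by positivity
    linarith
  -- Some window costs no more than the average one; it serves as the block.
  obtain ⟨u, hu, huX⟩ : ∃ u ∈ range (n - L), X u ≤ L * Y / (n - L) := by
    refine exists_le_of_sum_le ⟨0, mem_range.2 (by omega)⟩ (hsum.trans (le_of_eq ?_))
    rw [sum_const, card_range, nsmul_eq_mul, Nat.cast_sub hLn.le]
    field_simp
  have hK : ∀ K : ℕ, minE ρ (K * L) / ((K * L : ℕ) : ℝ) ≤ Y / (n - L) + 200000 * w ^ 2 / L := by
    intro K
    have hY0 : 0 ≤ Y := by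
      have := E_nonneg ρ s n
      have := harm_nonneg L
      positivity
    refine div_le_of_le_mul₀ (by positivity) (by positivity) ?_
    refine (minE_mul_le hρ (hs.shift u) hL hm hm1 hw1 hw K).trans ?_
    have h1 : X u + 200000 * w ^ 2 ≤ L * Y / (n - L) + 200000 * w ^ 2 := by linarith
    have h2 : (Y / (n - L) + 200000 * w ^ 2 / L) * ((K * L : ℕ) : ℝ)
        = K * (L * Y / (n - L) + 200000 * w ^ 2) := by
      push_cast
      field_simp
    rw [h2]
    exact mul_le_mul_of_nonneg_left h1 K.cast_nonneg
  -- The limit exists along all lengths, so multiples of `L` suffice to bound it.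
  have hsub : Tendsto (fun K : ℕ => K * L) atTop atTop :=
    tendsto_id.atTop_mul_const' hL
  exact le_of_tendsto (hσ.comp hsub) (Eventually.of_forall hK)

theorem density_le (hρ : |ρ| ≤ 1) {σ : ℝ}
    (hσ : Tendsto (fun n : ℕ => minE ρ n / n) atTop (𝓝 σ)) {n J : ℕ} (hJ : 1 ≤ J)
    (hn : 16 ^ (4 * J) ≤ n) : σ ≤ minE ρ n / n + 10 ^ 15 / J := by
  obtain ⟨s, hs, hmin⟩ := exists_E_eq_minE n ρ
  have hlin := minE_le_linear hρ n
  rw [← hmin] at hlin ⊢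
  have hE0 := E_nonneg ρ s n
  have hJ0 : (0 : ℝ) < J := by exact_mod_cast hJ
  -- Pigeonhole over `J` scales; `24 = 3 * 8` from `sum_shortW_le` and `W_le_pair`.
  obtain ⟨j, hj, hCj⟩ : ∃ j ∈ Ico J (2 * J),
      ∑ a ∈ range n, ∑ b ∈ range n, shortW ρ s (16 ^ j) a b ≤ 24 * E ρ s n / J := by
    refine exists_le_of_sum_le ⟨J, mem_Ico.2 ⟨le_rfl, by omega⟩⟩ ?_
    calc _ ≤ ∑ j ∈ range (2 * J), ∑ a ∈ range n, ∑ b ∈ range n, shortW ρ s (16 ^ j) a b := by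
          refine sum_le_sum_of_subset_of_nonneg (fun i hi => ?_) fun _ _ _ =>
            sum_nonneg fun _ _ => sum_nonneg fun _ _ => shortW_nonneg _ _ _ _ _
          exact mem_range.2 (mem_Ico.1 hi).2
      _ = ∑ a ∈ range n, ∑ b ∈ range n, ∑ j ∈ range (2 * J), shortW ρ s (16 ^ j) a b := by
          rw [sum_comm]
          exact sum_congr rfl fun a _ => sum_comm
      _ ≤ ∑ a ∈ range n, ∑ b ∈ range n, 24 * pair ρ s a b := by
          refine sum_le_sum fun a _ => sum_le_sum fun b _ => ?_
          linarith [sum_shortW_le ρ s (2 * J) a b, W_le_pair ρ s a b]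
      _ = 24 * E ρ s n := by
          unfold E
          simp only [mul_sum]
      _ = _ := by
          rw [sum_const, Nat.card_Ico, nsmul_eq_mul, show 2 * J - J = J by omega]
          field_simp
  obtain ⟨hj1, hj2⟩ := mem_Ico.1 hj
  have hj0 : (0 : ℝ) < j := by exact_mod_cast (by omega : 0 < j)
  have hjJ : (J : ℝ) ≤ j := by exact_mod_cast hj1
  have h16 : ((16 ^ j : ℕ) : ℝ) = 4 ^ j * 4 ^ j := by
    push_cast
    rw [← mul_pow]
    norm_num
  have h2p : (j : ℝ) ≤ 2 ^ j := by exact_mod_cast j.lt_two_pow_self.le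
  have hnR : (16 : ℝ) ^ j * (2 * J) ≤ n := by
    have h1 : 16 ^ j * (2 * J) ≤ 16 ^ (4 * J) := by
      calc 16 ^ j * (2 * J) ≤ 16 ^ (2 * J) * 16 ^ (2 * J) := by
            refine Nat.mul_le_mul (Nat.pow_le_pow_right (by norm_num) hj2.le) ?_
            exact (Nat.lt_pow_self (by norm_num)).le
        _ = _ := by rw [← pow_add]; congr 1; ring
    exact_mod_cast h1.trans hn
  set L := 16 ^ j with hLdef
  have hL1 : 1 ≤ L := Nat.one_le_pow _ _ (by norm_num)
  have hLR : (L : ℝ) = 16 ^ j := by rw [hLdef]; push_cast; ring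
  have hLpos : (0 : ℝ) < L := by exact_mod_cast hL1
  rw [← hLR] at hnR
  have hJ1 : (1 : ℝ) ≤ J := by exact_mod_cast hJ
  have hLn2 : 2 * (L : ℝ) ≤ n := by nlinarith
  have hLn : L < n := by
    have : (L : ℝ) < n := by linarith
    exact_mod_cast this
  have hnpos : (0 : ℝ) < n := by linarith
  -- This `m` is at most `1 / J`, and yet `w`, of order `j * 2 ^ j`, has `w ^ 2 / L` of order `j ^ 2
  -- / 4 ^ j`, since `L = 16 ^ j`.
  set m : ℝ := 1 / 2 ^ j with hm
  have hmJ : m ≤ 1 / J := one_div_le_one_div_of_le hJ0 (hjJ.trans h2p)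
  have hm0 : 0 < m := by positivity
  have hm1 : m ≤ 1 := by
    rw [hm]
    exact div_le_one_of_le₀ (one_le_pow₀ (by norm_num)) (by positivity)
  set w : ℝ := 5 * j * 2 ^ j with hw
  have hj1R : (1 : ℝ) ≤ j := hJ1.trans hjJ
  have hw1 : 1 ≤ w := by
    rw [hw]
    have : (1 : ℝ) ≤ 2 ^ j := one_le_pow₀ (by norm_num)
    nlinarith
  have hHj : harm L ≤ 5 * j := (harm_pow_le j).trans (by linarith)
  have hHw : harm L / m ≤ w := by
    rw [hm, hw, div_div_eq_mul_div, div_one]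
    gcongr
  have hwL : w ^ 2 / L ≤ 25 / J := by
    have h3 : (j : ℝ) ^ 3 ≤ 4 ^ j := by exact_mod_cast cube_le_four_pow j
    have h4 : w ^ 2 = 25 * j ^ 2 * 4 ^ j := by
      rw [hw, mul_pow, mul_pow, ← pow_mul, mul_comm j 2, pow_mul]
      norm_num
    rw [h4, h16, div_le_div_iff₀ (by positivity) hJ0]
    calc 25 * (j : ℝ) ^ 2 * 4 ^ j * J ≤ 25 * (j : ℝ) ^ 2 * 4 ^ j * j := by gcongr
      _ = 25 * ((j : ℝ) ^ 3 * 4 ^ j) := by ring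
      _ ≤ _ := by gcongr
  have hHL : harm L / L ≤ 25 / J := by
    refine le_trans ?_ hwL
    gcongr
    have h5 : harm L ≤ w := (le_div_self (harm_nonneg L) hm0 hm1).trans hHw
    nlinarith
  refine (density_le_of_scale hρ hs hσ hL1 hLn hm0 hm1 hw1 hHw).trans ?_
  set C := ∑ a ∈ range n, ∑ b ∈ range n, shortW ρ s L a b with hC
  have hnL : (0 : ℝ) < (n : ℝ) - L := by linarith
  have hCn : C ≤ 48000000 * n / J := by
    refine hCj.trans (div_le_div_of_nonneg_right ?_ hJ0.le)
    linarith
  have e1 : E ρ s n / (n - L) ≤ E ρ s n / n + 2000000 / J := by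
    have h6 : E ρ s n / (n - L) = E ρ s n / n + E ρ s n * L / (n * (n - L)) := by
      field_simp
      ring
    rw [h6]
    refine add_le_add le_rfl ?_
    rw [div_le_div_iff₀ (mul_pos hnpos hnL) hJ0]
    have h7 : (L : ℝ) * J ≤ n - L := by nlinarith
    calc E ρ s n * L * J = E ρ s n * (L * J) := by ring
      _ ≤ 2000000 * n * (n - L) := by gcongr
      _ = _ := by ring
  have e2 : m * E ρ s n / (n - L) ≤ 4000000 / J := by
    rw [mul_div_assoc]
    calc m * (E ρ s n / (n - L)) ≤ 1 / J * 4000000 := by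
          gcongr
          rw [div_le_iff₀ hnL]
          linarith
      _ = _ := by ring
  have e3 : C / (n - L) ≤ 96000000 / J := by
    rw [div_le_iff₀ hnL]
    refine hCn.trans ?_
    rw [div_mul_eq_mul_div]
    refine div_le_div_of_nonneg_right ?_ hJ0.le
    linarith
  have e4 : n * (harm L / L) / (n - L) ≤ 50 / J := by
    rw [div_le_iff₀ hnL]
    calc (n : ℝ) * (harm L / L) ≤ (2 * (n - L)) * (25 / J) := by
          have := harm_nonneg L
          gcongr
          linarith
      _ = _ := by ring
  have e5 : ((1 + m) * E ρ s n + 1700000 * C + 6400000 * n * (harm L / L)) / ((n : ℝ) - L)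
      + 200000 * w ^ 2 / L = E ρ s n / (n - L) + m * E ρ s n / (n - L) + 1700000 * (C / (n - L))
        + 6400000 * (n * (harm L / L) / (n - L)) + 200000 * (w ^ 2 / L) := by ring
  rw [e5]
  have e6 : (10 : ℝ) ^ 15 / J = 2000000 / J + 4000000 / J + 1700000 * (96000000 / J)
      + 6400000 * (50 / J) + 200000 * (25 / J) + 836799669000000 / J := by ring
  have e7 : 0 ≤ 836799669000000 / (J : ℝ) := by positivity
  rw [e6]
  linarith

theorem log_le_of_natLog (n : ℕ) (hn : n ≠ 0) : Real.log n ≤ Nat.log 2 n + 1 := by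
  have h1 : (n : ℝ) ≤ 2 ^ (Nat.log 2 n + 1) := by
    exact_mod_cast (Nat.lt_pow_succ_log_self (by norm_num) n).le
  have h2 := Real.log_le_log (by exact_mod_cast Nat.pos_of_ne_zero hn) h1
  rw [Real.log_pow] at h2
  push_cast at h2
  have h3 : Real.log 2 ≤ 1 := by linarith [Real.log_two_lt_d9]
  have h4 : (0 : ℝ) ≤ (Nat.log 2 n : ℝ) + 1 := by positivity
  nlinarith

theorem density_rate (hρ : |ρ| ≤ 1) {σ : ℝ}
    (hσ : Tendsto (fun n : ℕ => minE ρ n / n) atTop (𝓝 σ)) (hsup : ∀ n : ℕ, minE ρ n / n ≤ σ)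
    {n : ℕ} (hn : 2 ≤ n) : |minE ρ n / n - σ| ≤ 10 ^ 17 / Real.log n := by
  have hnR : (2 : ℝ) ≤ n := by exact_mod_cast hn
  have hlog : 0 < Real.log n := Real.log_pos (by linarith)
  rw [abs_sub_comm, abs_of_nonneg (sub_nonneg.2 (hsup n)), le_div_iff₀ hlog]
  have hL := log_le_of_natLog n (by omega)
  have hσ0 : 0 ≤ σ - minE ρ n / n := sub_nonneg.2 (hsup n)
  -- Chosen so that `16 ^ (4 * J) = 2 ^ (16 * J) ≤ n`. If `J = 0`, then `log n ≤ 16` and the crude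
  -- bound on `σ` suffices.
  set J := Nat.log 2 n / 16 with hJ
  have hJlog : Real.log n ≤ 16 * J + 16 := by
    have : Nat.log 2 n + 1 ≤ 16 * J + 16 := by omega
    have : (Nat.log 2 n : ℝ) + 1 ≤ 16 * J + 16 := by exact_mod_cast this
    linarith
  rcases Nat.eq_zero_or_pos J with h0 | hpos
  · rw [h0] at hJlog
    have h1 : σ ≤ 2000000 := le_of_tendsto hσ <| Eventually.of_forall fun k =>
      div_le_of_le_mul₀ k.cast_nonneg (by norm_num) (minE_le_linear hρ k)
    have h2 : 0 ≤ minE ρ n / n := div_nonneg (minE_nonneg n ρ) (by linarith)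
    norm_num at hJlog
    nlinarith
  · have hpow : 16 ^ (4 * J) ≤ n := by
      calc 16 ^ (4 * J) = 2 ^ (16 * J) := by
            rw [show (16 : ℕ) = 2 ^ 4 by norm_num, ← pow_mul]
            congr 1; ring
        _ ≤ 2 ^ Nat.log 2 n := Nat.pow_le_pow_right (by norm_num) (by omega)
        _ ≤ n := Nat.pow_log_le_self 2 (by omega)
    have h1 := density_le hρ hσ hpos hpow
    have hJ1 : (1 : ℝ) ≤ J := by exact_mod_cast hpos
    have h2 : σ - minE ρ n / n ≤ 10 ^ 15 / J := by linarith
    calc (σ - minE ρ n / n) * Real.log n ≤ 10 ^ 15 / J * (32 * J) := by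
          gcongr
          linarith
      _ = 10 ^ 15 * 32 := by field_simp
      _ ≤ 10 ^ 17 := by norm_num

/-! ### Continuity in the slope -/

theorem W_le_add (hs : IsStep s) {ρ' : ℝ} (hρ : |ρ| ≤ 1) (hρ' : |ρ'| ≤ 1) (i j : ℕ) :
    W ρ s i j ≤ W ρ' s i j + 4 * |ρ - ρ'| := by
  have := unit_integral_le (A := 1) (B := 4 * |ρ - ρ'|)
    (measurable_kern ρ ((i : ℝ) - j) ((ht s i : ℝ) - ht s j) (s i) (s j))
    (measurable_kern ρ' ((i : ℝ) - j) ((ht s i : ℝ) - ht s j) (s i) (s j))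
    (abs_kern_le_four hρ hs i j) (abs_kern_le_four hρ' hs i j) ?_
  · simpa [W] using this
  intro b hb a ha
  have hq : |((ht s i : ℝ) - ht s j + a * s i - b * s j) / ((i : ℝ) - j + a - b)| ≤ 1 := by
    rw [abs_div]
    exact div_le_one_of_le₀ (hs.abs_increment_le i j ha hb) (abs_nonneg _)
  unfold kern
  generalize ((ht s i : ℝ) - ht s j + a * s i - b * s j) / ((i : ℝ) - j + a - b) = q at hq
  have h1 : |2 * q - ρ - ρ'| ≤ 4 := by
    rw [abs_le] at hq hρ hρ' ⊢
    constructor <;> linarith [hq.1, hq.2, hρ.1, hρ.2, hρ'.1, hρ'.2]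
  have h2 : (q - ρ) ^ 2 = (q - ρ') ^ 2 + -((ρ - ρ') * (2 * q - ρ - ρ')) := by ring
  have h3 : -((ρ - ρ') * (2 * q - ρ - ρ')) ≤ |ρ - ρ'| * 4 := by
    refine (neg_le_abs _).trans ?_
    rw [abs_mul]
    gcongr
  linarith

/-- The Lipschitz constant grows with `n`, which is harmless: only continuity at each fixed `n`
enters the uniform limit. -/
theorem minE_le_add {ρ' : ℝ} (hρ : |ρ| ≤ 1) (hρ' : |ρ'| ≤ 1) (n : ℕ) :
    minE ρ n ≤ minE ρ' n + n ^ 2 * |ρ - ρ'| := by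
  obtain ⟨s, hs, h⟩ := exists_E_eq_minE n ρ'
  rw [← h]
  refine (minE_le n ρ hs).trans ?_
  calc E ρ s n ≤ ∑ i ∈ range n, ∑ j ∈ range n, (pair ρ' s i j + |ρ - ρ'|) := by
        refine sum_le_sum fun i _ => sum_le_sum fun j _ => ?_
        have := W_le_add hs hρ hρ' i j
        unfold pair
        linarith [abs_nonneg (ρ - ρ')]
    _ = _ := by
        unfold E
        simp only [sum_add_distrib, sum_const, card_range, nsmul_eq_mul]
        ring

theorem continuousOn_minE (n : ℕ) :
    ContinuousOn (fun ρ => minE ρ n / n) (Set.Icc (-1 : ℝ) 1) := by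
  have : LipschitzOnWith ((n : NNReal) ^ 2) (fun ρ => minE ρ n) (Set.Icc (-1 : ℝ) 1) := by
    refine LipschitzOnWith.of_le_add_mul _ fun x hx y hy => ?_
    have := minE_le_add (abs_le.2 hx) (abs_le.2 hy) n
    simpa [Real.dist_eq] using this
  exact this.continuousOn.div_const _

end LocalOpt

/-! ### Assembly: attained minima, rate and continuity. -/

theorem theorem2 :
    (∀ n : ℕ, 1 ≤ n → ∀ ρ ∈ Set.Icc (-1 : ℝ) 1,
      IsLeast (LocalOpt.Theta n ρ '' LocalOpt.Sloc n) (LocalOpt.sigmaLoc n ρ)) ∧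
    ∃ C : ℝ, 0 < C ∧ ∃ σ : ℝ → ℝ,
      (∀ ρ ∈ Set.Icc (-1 : ℝ) 1, 0 ≤ σ ρ ∧
        ∀ n : ℕ, 2 ≤ n → |LocalOpt.sigmaLoc n ρ / (n : ℝ) - σ ρ| ≤ C / Real.log (n : ℝ)) ∧
      ContinuousOn σ (Set.Icc (-1 : ℝ) 1) := by
  refine ⟨fun n hn ρ _ => LocalOpt.isLeast_sigmaLoc hn ρ, 10 ^ 17, by positivity, ?_⟩
  have hex : ∀ ρ : ℝ, ∃ σ : ℝ, ρ ∈ Set.Icc (-1 : ℝ) 1 →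
      Filter.Tendsto (fun n : ℕ => LocalOpt.minE ρ n / n) Filter.atTop (nhds σ) ∧
        ∀ n : ℕ, LocalOpt.minE ρ n / n ≤ σ := by
    intro ρ
    by_cases h : ρ ∈ Set.Icc (-1 : ℝ) 1
    · obtain ⟨σ, hσ⟩ := LocalOpt.exists_density (abs_le.2 h)
      exact ⟨σ, fun _ => hσ⟩
    · exact ⟨0, fun h' => absurd h' h⟩
  choose σ hσ using hex
  have hrate : ∀ ρ ∈ Set.Icc (-1 : ℝ) 1, ∀ n : ℕ, 2 ≤ n →
      |LocalOpt.minE ρ n / n - σ ρ| ≤ 10 ^ 17 / Real.log n := fun ρ hρ n hn =>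
    LocalOpt.density_rate (abs_le.2 hρ) (hσ ρ hρ).1 (hσ ρ hρ).2 hn
  refine ⟨σ, fun ρ hρ => ⟨?_, fun n hn => ?_⟩, ?_⟩
  · exact (div_nonneg (LocalOpt.minE_nonneg 1 ρ) (Nat.cast_nonneg 1)).trans ((hσ ρ hρ).2 1)
  · rw [LocalOpt.sigmaLoc_eq_minE (by omega)]
    exact hrate ρ hρ n hn
  -- The bound in `hrate` does not depend on `ρ`, so the convergence is uniform.
  · have hunif : TendstoUniformlyOn (fun (n : ℕ) ρ => LocalOpt.minE ρ n / n) σ Filter.atTop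
        (Set.Icc (-1 : ℝ) 1) := by
      rw [Metric.tendstoUniformlyOn_iff]
      intro ε hε
      have hlim : Filter.Tendsto (fun n : ℕ => (10 : ℝ) ^ 17 / Real.log n) Filter.atTop (nhds 0) :=
        (Real.tendsto_log_atTop.comp tendsto_natCast_atTop_atTop).const_div_atTop _
      filter_upwards [hlim.eventually_lt_const hε, Filter.eventually_ge_atTop 2] with n h1 h2 ρ hρ
      rw [dist_comm, Real.dist_eq]
      exact (hrate ρ hρ n h2).trans_lt h1
    exact hunif.continuousOn (Filter.Frequently.of_forall LocalOpt.continuousOn_minE)
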